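/- **Ordered boron trees.** For a graph-theoretic tree $T$ let $B(T)$ be its set of endpoints (vertices of valency $1$), with the relation $R(a,b,c,d)$ that holds iff $a,b,c,d$ are pairwise different and the arcs $ab$ and $cd$ of $T$ do not intersect. For $n\ge 2$ let $T_n$ be the tree obtained from the binary tree $2^{<n}$ of binary sequences of length $<n$ by removing the root $\emptyset$ and replacing its two edges by one edge $[0,1]$, and let $B_n=B(T_n)$. On $B_n$ let $\le_{lex}$ be the lexicographical order, and let $S(a,b,c)$ hold iff $a,b<_{lex}c$ and the longest common initial segment of $a$ and $b$ is longer than that of $b$ and $c$. An *ordered boron tree* is a finite structure $(A,R,S,\le_{lex})$ that embeds (with respect to all three relations) in $(B_n,R,S,\le_{lex})$ for some $n$. Let $\mathcal{SB}$ be the class of ordered boron trees. The *universal ordered boron tree* is its Fraïssé limit, i.e. the countable ultrahomogeneous structure $M$ whose age is $\mathcal{SB}$. **Partial automorphisms.** Let $\mathcal{SB}_2$ be the class of triples $(A,p_1,p_2)$ with $A\in\mathcal{SB}$ and $p_1,p_2$ partial automorphisms of $A$ (isomorphisms between substructures of $A$). An embedding of $(A,p_1,p_2)$ into $(B,q_1,q_2)$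 is an embedding $\phi\colon A\to B$ such that, for $i=1,2$ and every $x\in\operatorname{dom}(p_i)$, $q_i(\phi(x))$ is defined and equals $\phi(p_i(x))$. A class $\mathcal{F}$ has the *weak amalgamation property* (WAP) if for every $A\in\mathcal F$ there are $A'\in\mathcal F$ and an embedding $\phi\colon A\to A'$ such that for all $B,C\in\mathcal F$ and embeddings $\alpha\colon A'\to B$, $\beta\colon A'\to C$ there are $D\in\mathcal F$ and embeddings $\gamma\colon B\to D$, $\delta\colon C\to D$ with $\gamma\circ\alpha\circ\phi=\delta\circ\beta\circ\phi$. **Theorem.** The class $\mathcal{SB}_2$ does not have WAP. Moreover, if $M$ is the universal ordered boron tree and $\operatorname{Aut}(M)\subseteq M^M$ carries the topology induced by the product topology ($M$ discrete), then $\operatorname{Aut}(M)$ has no comeager $2$-dimensional diagonal conjugacy class: there is no $(f_1,f_2)\in\operatorname{Aut}(M)^2$ for which $\{(hf_1h^{-1},hf_2h^{-1}):h\in\operatorname{Aut}(M)\}$ is comeager in $\operatorname{Aut}(M)^2$. -/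

import Mathlib

universe u

namespace OrderedBoron

open FirstOrder FirstOrder.Language
open scoped FirstOrder

/-! ### Boron structures of graphs and the standard binary trees -/

/-- The endpoints of a graph `T`: the vertices of valency one. -/
abbrev Endpoint {V : Type} (T : SimpleGraph V) : Type :=
  {v : V // ∃! w, T.Adj v w}

/-- `ab|cd`: the arcs (paths) from `a` to `b` and from `c` to `d` do not intersect. In a tree
there is exactly one path between two vertices. -/
def ArcsDisjoint {V : Type} (T : SimpleGraph V) (a b c d : V) : Prop :=
  ∃ (p : T.Walk a b) (q : T.Walk c d), p.IsPath ∧ q.IsPath ∧ ∀ v, v ∈ p.support → v ∉ q.support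

/-- The quaternary relation of the boron structure of `T`, on the endpoints of `T`. -/
def boronRel {V : Type} (T : SimpleGraph V) (a b c d : Endpoint T) : Prop :=
  a ≠ b ∧ a ≠ c ∧ a ≠ d ∧ b ≠ c ∧ b ≠ d ∧ c ≠ d ∧ ArcsDisjoint T a.1 b.1 c.1 d.1

/-- The nonempty binary sequences of length `< n` (`false` is `0` and `true` is `1`). -/
abbrev Node (n : ℕ) : Type :=
  {s : List Bool // s ≠ [] ∧ s.length < n}

/-- The tree `T_n`: the binary tree of height `n` with the root `∅` removed and with the two edges
at the root replaced by one edge between `0` and `1`. -/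
def binTree (n : ℕ) : SimpleGraph (Node n) :=
  SimpleGraph.fromRel fun s t =>
    (∃ i : Bool, t.1 = s.1 ++ [i]) ∨ (s.1 = [false] ∧ t.1 = [true])

/-- The set of endpoints of `T_n`. -/
abbrev BinLeaf (n : ℕ) : Type :=
  Endpoint (binTree n)

/-- The binary sequence of a leaf of `T_n`. -/
def BinLeaf.seq {n : ℕ} (a : BinLeaf n) : List Bool :=
  a.1.1

/-- Strict lexicographic order: `s(i) < t(i)` at the least `i` with `s(i) ≠ t(i)`
(here `u` is the common part of `s` and `t` before `i`). -/
def lexLT (s t : List Bool) : Prop :=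
  ∃ u : List Bool, (u ++ [false]) <+: s ∧ (u ++ [true]) <+: t

/-- The meet of two binary sequences: their longest common initial segment. -/
def meet : List Bool → List Bool → List Bool
  | a :: s, b :: t => if a = b then a :: meet s t else []
  | _, _ => []

/-- `meet s t` is the greatest lower bound of `s` and `t` for the initial segment order. -/
theorem prefix_meet_iff (u s t : List Bool) : u <+: meet s t ↔ u <+: s ∧ u <+: t := by
  induction s generalizing u t with
  | nil => cases t <;> simp +contextual [meet]
  | cons a s ih =>
    cases t with
    | nil => simp +contextual [meet]
    | cons b t =>
      cases u with
      | nil => simp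
      | cons c u =>
        by_cases h : a = b
        · subst h
          simp only [meet, if_true, List.cons_prefix_cons, ih]
          tauto
        · simp only [meet, if_neg h, List.cons_prefix_cons]
          constructor
          · intro h'
            simp at h'
          · rintro ⟨⟨rfl, -⟩, rfl, -⟩
            exact absurd rfl h

/-! ### The language and the class of ordered boron trees -/

/-- The relation symbols of ordered boron trees: the quaternary `R`, the ternary `S` and the
binary `≤_lex`. -/
inductive Rel : ℕ → Type
  | R : Rel 4
  | S : Rel 3
  | le : Rel 2

/-- The (relational) language of ordered boron trees. -/
def lang : FirstOrder.Language.{0, 0} where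
  Functions := fun _ => Empty
  Relations := Rel

instance : lang.IsRelational := fun n => inferInstanceAs (IsEmpty ((fun _ : ℕ => Empty) n))

/-- The structure `(B_n, R, S, ≤_lex)` on the endpoints of `T_n`. -/
instance binLeafStructure (n : ℕ) : lang.Structure (BinLeaf n) where
  funMap := fun f _ => Empty.elim f
  RelMap := fun {_} r =>
    match r with
    | Rel.R => fun v => boronRel (binTree n) (v 0) (v 1) (v 2) (v 3)
    | Rel.S => fun v =>
        lexLT (v 0).seq (v 2).seq ∧ lexLT (v 1).seq (v 2).seq ∧
          (meet (v 1).seq (v 2).seq).length < (meet (v 0).seq (v 1).seq).length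
    | Rel.le => fun v => v 0 = v 1 ∨ lexLT (v 0).seq (v 1).seq

/-- The class `SB` of finite ordered boron trees: the finite structures `(A, R, S, ≤_lex)` which
are obtained from an embedding of `(A, R)` into some `(B_n, R)` by pulling back `S` and `≤_lex`,
that is, for which this map is an embedding for all three relations. (Such an `(A, R)` is itself
the boron structure of a tree, because boron trees are closed under substructures; the empty
structure is included.) -/
def SB : Set (CategoryTheory.Bundled.{u} lang.Structure) :=
  {A | Finite A ∧ ∃ n : ℕ, Nonempty (A ↪[lang] BinLeaf n)}

/-! ### Classes of tuples of partial automorphisms and the weak amalgamation property -/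

/-- The class `K_n`: a member of `K` together with `n` partial automorphisms of it
(isomorphisms between substructures). -/
structure PartialAutSystem {L : FirstOrder.Language.{0, 0}}
    (K : Set (CategoryTheory.Bundled.{u} L.Structure)) (n : ℕ) where
  carrier : CategoryTheory.Bundled.{u} L.Structure
  mem : carrier ∈ K
  aut : Fin n → (carrier ≃ₚ[L] carrier)

/-- An embedding of `(A, p_1, …, p_n)` into `(B, q_1, …, q_n)`: an embedding `φ` of `A` into `B`
such that, for all `i` and all `x` in the domain of `p_i`, the point `φ x` is in the domain of
`q_i` and `q_i (φ x) = φ (p_i x)`. -/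
structure SystemEmbedding {L : FirstOrder.Language.{0, 0}}
    {K : Set (CategoryTheory.Bundled.{u} L.Structure)} {n : ℕ}
    (A B : PartialAutSystem K n) where
  toEmbedding : A.carrier ↪[L] B.carrier
  map_aut : ∀ (i : Fin n) (x : (A.aut i).dom), ∃ h : toEmbedding (x : A.carrier) ∈ (B.aut i).dom,
    ((B.aut i).toEquiv ⟨toEmbedding (x : A.carrier), h⟩ : B.carrier) =
      toEmbedding ((A.aut i).toEquiv x : A.carrier)

/-- The weak amalgamation property of the class `K_n`. -/
def HasWAP {L : FirstOrder.Language.{0, 0}} (K : Set (CategoryTheory.Bundled.{u} L.Structure)) (n : ℕ) :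
    Prop :=
  ∀ A : PartialAutSystem K n, ∃ (A' : PartialAutSystem K n) (φ : SystemEmbedding A A'),
    ∀ (B C : PartialAutSystem K n) (α : SystemEmbedding A' B) (β : SystemEmbedding A' C),
      ∃ (D : PartialAutSystem K n) (γ : SystemEmbedding B D) (δ : SystemEmbedding C D),
        ∀ x : A.carrier,
          γ.toEmbedding (α.toEmbedding (φ.toEmbedding x)) =
            δ.toEmbedding (β.toEmbedding (φ.toEmbedding x))

/-! ### Diagonal conjugacy classes in automorphism groups -/

/-- The topology of `Aut(M) ⊆ M^M`, where `M` is discrete and `M^M` has the product topology. -/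
instance autTopology (L : FirstOrder.Language.{0, 0}) (M : Type u) [L.Structure M] :
    TopologicalSpace (M ≃[L] M) :=
  TopologicalSpace.induced (fun g => (g : M → M))
    (@Pi.topologicalSpace M (fun _ => M) (fun _ => ⊥))

/-- The `n`-dimensional diagonal conjugacy class of `f` in `Aut(M)`: all tuples
`(h f_1 h⁻¹, …, h f_n h⁻¹)` with `h` in `Aut(M)`. -/
def diagonalClass {L : FirstOrder.Language.{0, 0}} {M : Type u} [L.Structure M] {n : ℕ}
    (f : Fin n → (M ≃[L] M)) : Set (Fin n → (M ≃[L] M)) :=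
  {g | ∃ h : M ≃[L] M, ∀ i, g i = (h.comp (f i)).comp h.symm}

/-- `Aut(M)` has a comeager `n`-dimensional diagonal conjugacy class. -/
def HasComeagerDiagonalClass (L : FirstOrder.Language.{0, 0}) (M : Type u) [L.Structure M] (n : ℕ) : Prop :=
  ∃ f : Fin n → (M ≃[L] M), diagonalClass f ∈ residual (Fin n → (M ≃[L] M))

end OrderedBoron

namespace OrderedBoron

open FirstOrder FirstOrder.Language
open scoped FirstOrder

/-! ### Binary sequences: meets and the lexicographic order -/

/-! An ordered boron tree is governed by the levels at which its points branch. In `B_n` the level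
of two leaves is the length of their meet, and `R`, `S` are inequalities between levels
(`binLeafLevelModel`). Conversely the order and the relation `CRel x y z` ("`y` and `z` lie in a
cone avoiding `x`") determine `R`, `S` and `≤_lex`, so a map preserving these two is an embedding
(`embeddingOfPreserves`). A new point `m` branching off from `b` is described by its side of `b` and
by which points leave the branch of `b` below or above it (`Preserves.insert`). This makes the
leaves that differ finitely from a dense and codense 2-colouring of the rationals into a Fraïssé
limit, `UnivTree`, in which all finite systems can be realised by automorphisms.

The obstruction to amalgamation is `exists_word_undecided`. Let two automorphisms fix `b`, and let
one of them move a point `a < b` towards `b`. Then the orbit of `a` under words climbs along the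
branch of `b` without a last point. Given a finite set `F`, consider the first step at which a path
in the orbit climbs past all points of `F` and their images that lie below some orbit point. It is
made by one of the two automorphisms and ends in some `m`. The value of the other automorphism at
`m` is still free: it may be `m`, or a point further up. Hence some word `u⁻¹ j u` fixes `a` for one
pair agreeing with the given one on `F`, and moves `a` for another.

For WAP, start from the system with domain `{a, b}`. Any extension `A'` has two further extensions
in which the same word respectively fixes and moves the image of `a`; in an amalgam over `A` these
images coincide, a contradiction.

For conjugacy classes, split a comeager class of `f` into countably many pieces according to the
images of `a` and `b` under the conjugating map. By Baire one piece is dense in some nonempty open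
set. On a piece, whether a word fixes the image of `a` is decided by `f` alone, while the lemma
gives both answers within that open set. -/

theorem meet_prefix_left (s t : List Bool) : meet s t <+: s :=
  ((prefix_meet_iff _ s t).1 List.prefix_rfl).1

theorem meet_prefix_right (s t : List Bool) : meet s t <+: t :=
  ((prefix_meet_iff _ s t).1 List.prefix_rfl).2

theorem prefix_antisymm {s t : List Bool} (h : s <+: t) (h' : t <+: s) : s = t :=
  h.eq_of_length (le_antisymm h.length_le h'.length_le)

theorem meet_comm (s t : List Bool) : meet s t = meet t s :=
  prefix_antisymm ((prefix_meet_iff _ _ _).2 ⟨meet_prefix_right s t, meet_prefix_left s t⟩)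
    ((prefix_meet_iff _ _ _).2 ⟨meet_prefix_right t s, meet_prefix_left t s⟩)

theorem meet_self (s : List Bool) : meet s s = s :=
  prefix_antisymm (meet_prefix_left s s) ((prefix_meet_iff _ _ _).2 ⟨List.prefix_rfl, List.prefix_rfl⟩)

theorem length_meet_ultra (s t r : List Bool) :
    min (meet s t).length (meet t r).length ≤ (meet s r).length := by
  rcases le_total (meet s t).length (meet t r).length with h | h
  · have h1 := List.prefix_of_prefix_length_le (meet_prefix_right s t) (meet_prefix_left t r) h
    have h2 := (prefix_meet_iff _ s r).2 ⟨meet_prefix_left s t, h1.trans (meet_prefix_right t r)⟩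
    exact (min_le_left _ _).trans h2.length_le
  · have h1 := List.prefix_of_prefix_length_le (meet_prefix_left t r) (meet_prefix_right s t) h
    have h2 := (prefix_meet_iff _ s r).2 ⟨h1.trans (meet_prefix_left s t), meet_prefix_right t r⟩
    exact (min_le_right _ _).trans h2.length_le

theorem length_meet_lt {s t : List Bool} (hl : s.length = t.length) (h : s ≠ t) :
    (meet s t).length < t.length := by
  refine lt_of_le_of_ne (meet_prefix_right s t).length_le fun h' => h ?_
  exact ((meet_prefix_left s t).eq_of_length (h'.trans hl.symm)).symm.trans
    ((meet_prefix_right s t).eq_of_length h')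

theorem append_singleton_prefix_unique {u v s : List Bool} {i j : Bool} (hl : u.length = v.length)
    (hu : (u ++ [i]) <+: s) (hv : (v ++ [j]) <+: s) : i = j := by
  have h := List.prefix_of_prefix_length_le hu hv (by simp [hl])
  have := h.eq_of_length (by simp [hl])
  exact (List.append_singleton_inj.1 this).2

theorem lexLT.meet_eq {s t u : List Bool} (h0 : (u ++ [false]) <+: s) (h1 : (u ++ [true]) <+: t) :
    meet s t = u := by
  have hu : u <+: meet s t := (prefix_meet_iff _ _ _).2
    ⟨(List.prefix_append _ _).trans h0, (List.prefix_append _ _).trans h1⟩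
  by_contra hne
  have hlt : u.length < (meet s t).length :=
    lt_of_le_of_ne hu.length_le fun h => hne (hu.eq_of_length h).symm
  have a0 := List.prefix_of_prefix_length_le h0 (meet_prefix_left s t) (by simpa using hlt)
  have a1 := List.prefix_of_prefix_length_le h1 (meet_prefix_right s t) (by simpa using hlt)
  exact Bool.false_ne_true (append_singleton_prefix_unique rfl a0 a1)

theorem lexLT_iff {s t : List Bool} :
    lexLT s t ↔ (meet s t ++ [false]) <+: s ∧ (meet s t ++ [true]) <+: t := by
  constructor
  · rintro ⟨u, h0, h1⟩
    rw [lexLT.meet_eq h0 h1]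
    exact ⟨h0, h1⟩
  · exact fun h => ⟨_, h⟩

theorem lexLT.asymm {s t : List Bool} (h : lexLT s t) : ¬ lexLT t s := by
  intro h'
  rw [lexLT_iff] at h h'
  rw [meet_comm t s] at h'
  exact Bool.false_ne_true (append_singleton_prefix_unique rfl h.1 h'.2)

theorem lexLT_trichotomy {s t : List Bool} (hl : s.length = t.length) (h : s ≠ t) :
    lexLT s t ∨ lexLT t s := by
  induction s generalizing t with
  | nil => cases t <;> simp_all
  | cons a s ih =>
    cases t with
    | nil => simp at hl
    | cons b t =>
      by_cases hab : a = b
      · subst hab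
        rcases ih (t := t) (by simpa using hl) (by simpa using h) with ⟨u, h0, h1⟩ | ⟨u, h0, h1⟩
        · exact Or.inl ⟨a :: u, by simpa using h0, by simpa using h1⟩
        · exact Or.inr ⟨a :: u, by simpa using h0, by simpa using h1⟩
      · cases a <;> cases b
        · exact absurd rfl hab
        · exact Or.inl ⟨[], by simp, by simp⟩
        · exact Or.inr ⟨[], by simp, by simp⟩
        · exact absurd rfl hab

theorem lexLT.congr_right {s t r : List Bool} (hc : (meet s t).length < (meet t r).length)
    (h : lexLT s t) : lexLT s r := by
  rw [lexLT_iff] at h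
  exact ⟨_, h.1, (List.prefix_of_prefix_length_le h.2 (meet_prefix_left t r)
    (by simpa using hc)).trans (meet_prefix_right t r)⟩

theorem lexLT.congr_left {s t r : List Bool} (hc : (meet s t).length < (meet t r).length)
    (h : lexLT t s) : lexLT r s := by
  rw [lexLT_iff, meet_comm t s] at h
  exact ⟨_, (List.prefix_of_prefix_length_le h.1 (meet_prefix_left t r)
    (by simpa using hc)).trans (meet_prefix_right t r), h.2⟩

/-- Branching is binary: at a common branching level `t` would need the bit 1, being above `s`, and
the bit 0, being below `r`. -/
theorem lexLT.length_meet_ne {s t r : List Bool} (h : lexLT s t) (h' : lexLT t r) :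
    (meet s t).length ≠ (meet t r).length := by
  intro he
  rw [lexLT_iff] at h h'
  exact Bool.false_ne_true (append_singleton_prefix_unique he h.2 h'.1).symm

/-! ### Adjacency and endpoints of the standard binary trees -/

theorem binTree_adj {n : ℕ} {s t : Node n} : (binTree n).Adj s t ↔
    (∃ i : Bool, t.1 = s.1 ++ [i]) ∨ (∃ i : Bool, s.1 = t.1 ++ [i]) ∨
      (s.1 = [false] ∧ t.1 = [true]) ∨ (t.1 = [false] ∧ s.1 = [true]) := by
  simp only [binTree, SimpleGraph.fromRel_adj]
  constructor
  · tauto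
  · intro h
    refine ⟨?_, by tauto⟩
    rintro rfl
    rcases h with ⟨i, h⟩ | ⟨i, h⟩ | ⟨h, h'⟩ | ⟨h, h'⟩
    · simp at h
    · simp at h
    · simp [h] at h'
    · simp [h] at h'

/-- A shorter sequence has two children in `T_n`, hence two neighbours. -/
theorem BinLeaf.length_seq {n : ℕ} (a : BinLeaf n) : a.seq.length = n - 1 := by
  obtain ⟨⟨s, hs, hl⟩, w, hw, huniq⟩ := a
  change s.length = n - 1
  by_contra hne
  have hlt : s.length + 1 < n := by omega
  have key : ∀ i : Bool, (⟨s ++ [i], by simp, by simpa using hlt⟩ : Node n) = w := fun i =>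
    huniq _ (binTree_adj.2 (Or.inl ⟨i, rfl⟩))
  have := (key false).trans (key true).symm
  simp at this

theorem BinLeaf.seq_injective {n : ℕ} : Function.Injective (BinLeaf.seq (n := n)) :=
  fun _ _ h => Subtype.ext (Subtype.ext h)

/-- Every binary sequence of length `n - 1 ≥ 2` is an endpoint of `T_n`. -/
theorem exists_binLeaf {n : ℕ} (s : List Bool) (h2 : 2 ≤ s.length) (hl : s.length + 1 = n) :
    ∃ a : BinLeaf n, a.seq = s := by
  obtain ⟨t, i, rfl⟩ : ∃ t i, s = t ++ [i] := by
    rcases List.eq_nil_or_concat s with h | ⟨t, i, h⟩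
    · simp [h] at h2
    · exact ⟨t, i, by simpa using h⟩
  have ht : t ≠ [] := by
    rintro rfl
    simp at h2
  have hl' : t.length + 1 + 1 = n := by simpa using hl
  refine ⟨⟨⟨t ++ [i], by simp, by simp; omega⟩, ⟨t, ht, by omega⟩, binTree_adj.2 (Or.inr (Or.inl ⟨i, rfl⟩)), ?_⟩, rfl⟩
  rintro ⟨w, hw, hwl⟩ hadj
  rcases binTree_adj.1 hadj with ⟨j, h⟩ | ⟨j, h⟩ | ⟨h, h'⟩ | ⟨h, h'⟩
  · have := congrArg List.length h
    simp at this
    omega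
  · exact Subtype.ext (List.append_singleton_inj.1 h).1.symm
  · have := congrArg List.length h
    simp at this
    exact absurd this ht
  · have := congrArg List.length h'
    simp at this
    exact absurd this ht

/-! ### Arcs of the standard binary trees -/

/-- A walk which leaves the cone above the node `v` passes through `v` and through the parent
of `v`, if there is one. -/
theorem mem_support_of_exit {n : ℕ} {s t : Node n} (p : (binTree n).Walk s t) {v : Node n}
    (hs : v.1 <+: s.1) (ht : ¬ v.1 <+: t.1) : v ∈ p.support ∧
      ∀ v' : Node n, (∃ i, v.1 = v'.1 ++ [i]) → v' ∈ p.support := by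
  obtain ⟨d, hd, hin, hout⟩ := p.exists_boundary_dart {w | v.1 <+: w.1} hs ht
  have hin' : v.1 <+: d.fst.1 := hin
  have hout' : ¬ v.1 <+: d.snd.1 := hout
  have hf := p.dart_fst_mem_support_of_mem_darts hd
  have hsn := p.dart_snd_mem_support_of_mem_darts hd
  rcases binTree_adj.1 d.adj with ⟨i, h⟩ | ⟨i, h⟩ | ⟨h, h'⟩ | ⟨h, h'⟩
  · exact absurd (hin'.trans (h ▸ List.prefix_append _ _)) hout'
  · rw [h, List.prefix_concat_iff] at hin'
    have hv : v = d.fst := Subtype.ext ((hin'.resolve_right hout').trans h.symm)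
    subst hv
    refine ⟨hf, ?_⟩
    rintro v' ⟨j, hj⟩
    have : v' = d.snd := Subtype.ext (List.append_singleton_inj.1 (hj.symm.trans h)).1
    rwa [this]
  all_goals
    have h1 : v.1 = d.fst.1 := by
      refine hin'.eq_of_length (le_antisymm hin'.length_le ?_)
      have := List.length_pos_iff.2 v.2.1
      simp only [h, h', List.length_singleton]
      omega
    refine ⟨Subtype.ext h1 ▸ hf, ?_⟩
    rintro v' ⟨j, hj⟩
    have := congrArg List.length (hj.symm.trans h1)
    simp only [h, h', List.length_append, List.length_singleton] at this
    have := List.length_pos_iff.2 v'.2.1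
    omega

/-- The path between two leaves passes through the nodes below them not below their meet. -/
theorem mem_support_of_prefix {n : ℕ} {a b : BinLeaf n} (hab : a ≠ b)
    (p : (binTree n).Walk a.1 b.1) {v : Node n} (hv : v.1 <+: a.seq)
    (hl : (meet a.seq b.seq).length ≤ v.1.length) : v ∈ p.support := by
  by_cases hb : v.1 <+: b.seq
  · have hm : v.1 = meet a.seq b.seq := by
      have := (prefix_meet_iff _ _ _).2 ⟨hv, hb⟩
      exact this.eq_of_length (le_antisymm this.length_le hl)
    have hne : a.seq ≠ b.seq := fun h => hab (BinLeaf.seq_injective h)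
    have hlen : a.seq.length = b.seq.length := by rw [a.length_seq, b.length_seq]
    have : ∃ i, (v.1 ++ [i]) <+: a.seq ∧ ¬ (v.1 ++ [i]) <+: b.seq := by
      rcases lexLT_trichotomy hlen hne with h | h
      · rw [lexLT_iff, ← hm] at h
        exact ⟨false, h.1, fun h' => Bool.false_ne_true (append_singleton_prefix_unique rfl h' h.2)⟩
      · rw [lexLT_iff, meet_comm, ← hm] at h
        exact ⟨true, h.2, fun h' => Bool.false_ne_true (append_singleton_prefix_unique rfl h.1 h')⟩
    obtain ⟨i, hi, hi'⟩ := this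
    exact (mem_support_of_exit p (v := ⟨v.1 ++ [i], by simp, hi.length_le.trans_lt a.1.2.2⟩) hi hi').2
      v ⟨i, rfl⟩
  · exact (mem_support_of_exit p hv hb).1

/-- The descending walk from a node to a nonempty initial segment. -/
theorem exists_walk_to_prefix {n : ℕ} {v : Node n} (s : List Bool) (hs : s ≠ [] ∧ s.length < n)
    (h : v.1 <+: s) : ∃ p : (binTree n).Walk ⟨s, hs⟩ v, ∀ w ∈ p.support, v.1 <+: w.1 ∧ w.1 <+: s := by
  induction s using List.reverseRecOn with
  | nil => exact absurd rfl hs.1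
  | append_singleton s i ih =>
    rcases List.prefix_concat_iff.1 h with h | h
    · obtain rfl : v = ⟨s ++ [i], hs⟩ := Subtype.ext h
      exact ⟨SimpleGraph.Walk.nil, by simp⟩
    · have hs' : s ≠ [] ∧ s.length < n := by
        refine ⟨?_, ?_⟩
        · rintro rfl
          exact v.2.1 (List.prefix_nil.1 h)
        · have := hs.2
          simp at this
          omega
      obtain ⟨p, hp⟩ := ih hs' h
      have hadj : (binTree n).Adj ⟨s ++ [i], hs⟩ ⟨s, hs'⟩ := binTree_adj.2 (Or.inr (Or.inl ⟨i, rfl⟩))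
      refine ⟨SimpleGraph.Walk.cons hadj p, fun w hw => ?_⟩
      rw [SimpleGraph.Walk.support_cons, List.mem_cons] at hw
      rcases hw with rfl | hw
      · exact ⟨h.trans (List.prefix_append _ _), List.prefix_rfl⟩
      · exact ⟨(hp w hw).1, (hp w hw).2.trans (List.prefix_append _ _)⟩

/-- Two nodes above `v` are joined by a walk above `v`. -/
theorem exists_walk_above {n : ℕ} {s t v : Node n} (hs : v.1 <+: s.1) (ht : v.1 <+: t.1) :
    ∃ p : (binTree n).Walk s t, ∀ w ∈ p.support, v.1 <+: w.1 := by
  obtain ⟨p, hp⟩ := exists_walk_to_prefix s.1 s.2 hs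
  obtain ⟨q, hq⟩ := exists_walk_to_prefix t.1 t.2 ht
  refine ⟨p.append q.reverse, fun w hw => ?_⟩
  rw [SimpleGraph.Walk.mem_support_append_iff, SimpleGraph.Walk.support_reverse,
    List.mem_reverse] at hw
  exact hw.elim (fun h => (hp w h).1) (fun h => (hq w h).1)

/-- Any two nodes are joined by a walk consisting of initial segments of these nodes. -/
theorem exists_walk_below {n : ℕ} (s t : Node n) :
    ∃ p : (binTree n).Walk s t, ∀ w ∈ p.support, w.1 <+: s.1 ∨ w.1 <+: t.1 := by
  have key : ∀ s : Node n, ∃ i : Bool, ∃ h : [i] ≠ [] ∧ [i].length < n, [i] <+: s.1 := by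
    rintro ⟨_ | ⟨i, s⟩, hs, hl⟩
    · exact absurd rfl hs
    · exact ⟨i, ⟨by simp, by simp at hl ⊢; omega⟩, by simp⟩
  obtain ⟨i, hi, his⟩ := key s
  obtain ⟨j, hj, hjt⟩ := key t
  obtain ⟨p, hp⟩ := exists_walk_to_prefix (v := ⟨[i], hi⟩) s.1 s.2 his
  obtain ⟨q, hq⟩ := exists_walk_to_prefix (v := ⟨[j], hj⟩) t.1 t.2 hjt
  by_cases hij : i = j
  · subst hij
    refine ⟨p.append q.reverse, fun w hw => ?_⟩
    rw [SimpleGraph.Walk.mem_support_append_iff, SimpleGraph.Walk.support_reverse,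
      List.mem_reverse] at hw
    exact hw.imp (fun h => (hp w h).2) (fun h => (hq w h).2)
  · have hadj : (binTree n).Adj ⟨[i], hi⟩ ⟨[j], hj⟩ := by
      rw [binTree_adj]
      cases i <;> cases j <;> simp_all
    refine ⟨p.append (SimpleGraph.Walk.cons hadj q.reverse), fun w hw => ?_⟩
    rw [SimpleGraph.Walk.mem_support_append_iff, SimpleGraph.Walk.support_cons, List.mem_cons,
      SimpleGraph.Walk.support_reverse, List.mem_reverse] at hw
    rcases hw with h | rfl | h
    · exact Or.inl (hp w h).2
    · exact Or.inl his
    · exact Or.inr (hq w h).2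

theorem arcsDisjoint_comm {V : Type} {T : SimpleGraph V} {a b c d : V} :
    ArcsDisjoint T a b c d ↔ ArcsDisjoint T c d a b :=
  ⟨fun ⟨p, q, hp, hq, h⟩ => ⟨q, p, hq, hp, fun v hv hv' => h v hv' hv⟩,
    fun ⟨p, q, hp, hq, h⟩ => ⟨q, p, hq, hp, fun v hv hv' => h v hv' hv⟩⟩

/-- The meet of `a` and `b` is a node `v`, and `a`, `b` are joined inside the cone above `v`. The
ends `c`, `d` are joined through initial segments of themselves, none of which extends `v`. -/
theorem arcsDisjoint_of_cone {n : ℕ} {a b c d : BinLeaf n}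
    (hc : (meet c.seq a.seq).length < (meet a.seq b.seq).length)
    (hd : (meet d.seq a.seq).length < (meet a.seq b.seq).length) :
    ArcsDisjoint (binTree n) a.1 b.1 c.1 d.1 := by
  classical
  let v : Node n := ⟨meet a.seq b.seq, fun h => by simp [h] at hc,
    (meet_prefix_left _ _).length_le.trans_lt a.1.2.2⟩
  have hv : ∀ e : BinLeaf n, (meet e.seq a.seq).length < (meet a.seq b.seq).length →
      ∀ w : Node n, w.1 <+: e.seq → ¬ v.1 <+: w.1 := fun e he w hw h =>
    absurd ((prefix_meet_iff _ _ _).2 ⟨h.trans hw, meet_prefix_left a.seq b.seq⟩).length_le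
      (not_le.2 he)
  obtain ⟨p, hp⟩ := exists_walk_above (v := v) (s := a.1) (t := b.1)
    (meet_prefix_left _ _) (meet_prefix_right _ _)
  obtain ⟨q, hq⟩ := exists_walk_below c.1 d.1
  refine ⟨p.bypass, q.bypass, p.bypass_isPath, q.bypass_isPath, fun w hw hw' => ?_⟩
  have h1 := hp w (p.support_bypass_subset_support hw)
  rcases hq w (q.support_bypass_subset_support hw') with h | h
  · exact hv c hc w h h1
  · exact hv d hd w h h1

/-- Arcs between leaves of `T_n` are disjoint iff one of them lies in a cone avoiding the ends
of the other. -/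
theorem arcsDisjoint_iff {n : ℕ} {a b c d : BinLeaf n} (hab : a ≠ b) (hcd : c ≠ d) :
    ArcsDisjoint (binTree n) a.1 b.1 c.1 d.1 ↔
      ((meet c.seq a.seq).length < (meet a.seq b.seq).length ∧
        (meet d.seq a.seq).length < (meet a.seq b.seq).length) ∨
      ((meet a.seq c.seq).length < (meet c.seq d.seq).length ∧
        (meet b.seq c.seq).length < (meet c.seq d.seq).length) := by
  constructor
  · rintro ⟨p, q, -, -, hpq⟩
    by_contra hcon
    have common : ∀ v : Node n, (v.1 <+: a.seq ∨ v.1 <+: b.seq) → (v.1 <+: c.seq ∨ v.1 <+: d.seq) →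
        (meet a.seq b.seq).length ≤ v.1.length → (meet c.seq d.seq).length ≤ v.1.length → False := by
      intro v h1 h2 h3 h4
      refine hpq v ?_ ?_
      · rcases h1 with h | h
        · exact mem_support_of_prefix hab p h h3
        · simpa using mem_support_of_prefix hab.symm p.reverse h (by rwa [meet_comm])
      · rcases h2 with h | h
        · exact mem_support_of_prefix hcd q h h4
        · simpa using mem_support_of_prefix hcd.symm q.reverse h (by rwa [meet_comm])
    -- The meet of an end of one arc with an end of the other, if at least as long as both arc
    -- meets, lies on both arcs, provided it is nonempty. The bound contains 1 because the root is
    -- not a node.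
    have pair : ∀ x y : BinLeaf n, (x = a ∨ x = b) → (y = c ∨ y = d) →
        (meet x.seq y.seq).length < max (max (meet a.seq b.seq).length (meet c.seq d.seq).length) 1 := by
      intro x y hx hy
      by_contra! hle
      refine common ⟨meet x.seq y.seq, fun h => by simp [h] at hle,
        (meet_prefix_left _ _).length_le.trans_lt x.1.2.2⟩ ?_ ?_ ?_ ?_
      · rcases hx with rfl | rfl
        · exact Or.inl (meet_prefix_left _ _)
        · exact Or.inr (meet_prefix_left _ _)
      · rcases hy with rfl | rfl
        · exact Or.inl (meet_prefix_right _ _)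
        · exact Or.inr (meet_prefix_right _ _)
      · exact (le_max_left _ _).trans ((le_max_left _ _).trans hle)
      · exact (le_max_right _ _).trans ((le_max_left _ _).trans hle)
    have hac := pair a c (Or.inl rfl) (Or.inl rfl)
    have had := pair a d (Or.inl rfl) (Or.inr rfl)
    have hbc := pair b c (Or.inr rfl) (Or.inl rfl)
    have hbd := pair b d (Or.inr rfl) (Or.inr rfl)
    rw [meet_comm c.seq a.seq, meet_comm d.seq a.seq] at hcon
    have key : ∃ i : Bool, ([i] <+: a.seq ∨ [i] <+: b.seq) ∧ [i] <+: c.seq ∨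
        1 ≤ (meet a.seq b.seq).length := by
      rcases Nat.eq_zero_or_pos (meet a.seq b.seq).length with h0 | h0
      · have hne : a.seq ≠ b.seq := fun h => hab (BinLeaf.seq_injective h)
        have hlen : a.seq.length = b.seq.length := by rw [a.length_seq, b.length_seq]
        have h0' := List.eq_nil_of_length_eq_zero h0
        have hi : ∀ i : Bool, [i] <+: a.seq ∨ [i] <+: b.seq := by
          rcases lexLT_trichotomy hlen hne with h | h
          · rw [lexLT_iff, h0'] at h
            rintro (_ | _)
            · exact Or.inl h.1
            · exact Or.inr h.2
          · rw [lexLT_iff, meet_comm, h0'] at h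
            rintro (_ | _)
            · exact Or.inr h.1
            · exact Or.inl h.2
        rcases hcs : c.seq with _ | ⟨i, s⟩
        · exact absurd hcs c.1.2.1
        · exact ⟨i, Or.inl ⟨hi i, by simp⟩⟩
      · exact ⟨true, Or.inr h0⟩
    -- If both meets were empty, both arcs would use the edge between `[false]` and `[true]`, and so
    -- share the node given by the first bit of `c`.
    have hpos : 1 ≤ max (meet a.seq b.seq).length (meet c.seq d.seq).length := by
      obtain ⟨i, h | h⟩ := key
      · by_contra! h0
        obtain ⟨h0, h0'⟩ := max_lt_iff.1 h0
        have hn : [i].length < n := (h.2.length_le).trans_lt c.1.2.2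
        exact common ⟨[i], by simp, hn⟩ h.1 (Or.inl h.2) (by simp; omega) (by simp; omega)
      · exact h.trans (le_max_left _ _)
    rw [max_eq_left hpos] at hac had hbc hbd
    omega
  · rintro (⟨h, h'⟩ | ⟨h, h'⟩)
    · exact arcsDisjoint_of_cone h h'
    · exact arcsDisjoint_comm.1 (arcsDisjoint_of_cone h h')

/-! ### Level functions on ordered boron structures -/

section relations

variable {X : Type*} [lang.Structure X]

/-- The weak order `≤_lex`. -/
def LeRel (x y : X) : Prop := Structure.RelMap (L := lang) (Rel.le : lang.Relations 2) ![x, y]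

/-- The strict order `<_lex`. -/
def LtRel (x y : X) : Prop := LeRel x y ∧ x ≠ y

/-- The ternary relation `S`. -/
def SRel (x y z : X) : Prop := Structure.RelMap (L := lang) (Rel.S : lang.Relations 3) ![x, y, z]

/-- The quaternary relation `R`. -/
def RRel (x y z w : X) : Prop :=
  Structure.RelMap (L := lang) (Rel.R : lang.Relations 4) ![x, y, z, w]

/-- The ternary relation `x | yz`: some cone contains `y` and `z` and avoids `x`. -/
def CRel (x y z : X) : Prop :=
  SRel y z x ∨ (LtRel x y ∧ LtRel x z ∧ ¬ SRel x y z ∧ ¬ SRel x z y)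

end relations

/-- A level function of an ordered boron structure: `lev x y` measures the height of the meet of
`x` and `y`. -/
structure LevelModel (X : Type*) [lang.Structure X] (Λ : Type*) [LinearOrder Λ] where
  lev : X → X → Λ
  lev_comm : ∀ x y, lev x y = lev y x
  lev_ultra : ∀ x y z, min (lev x y) (lev y z) ≤ lev x z
  lev_lt_self : ∀ x y, x ≠ y → lev x y < lev y y
  le_refl : ∀ x : X, LeRel x x
  total : ∀ x y : X, x ≠ y → LtRel x y ∨ LtRel y x
  asymm : ∀ x y : X, LtRel x y → ¬ LtRel y x
  congr_right : ∀ x y z, lev x y < lev y z → LtRel x y → LtRel x z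
  congr_left : ∀ x y z, lev x y < lev y z → LtRel y x → LtRel z x
  lev_ne : ∀ x y z, LtRel x y → LtRel y z → lev x y ≠ lev y z
  S_iff : ∀ x y z, SRel x y z ↔ LtRel x z ∧ LtRel y z ∧ lev y z < lev x y
  R_iff : ∀ a b c d, RRel a b c d ↔ a ≠ b ∧ a ≠ c ∧ a ≠ d ∧ b ≠ c ∧ b ≠ d ∧ c ≠ d ∧
    ((lev c a < lev a b ∧ lev d a < lev a b) ∨ (lev a c < lev c d ∧ lev b c < lev c d))

/-- The lengths of meets form a level function on `B_n`. -/
def binLeafLevelModel (n : ℕ) : LevelModel (BinLeaf n) ℕ :=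
  have hlen (x y : BinLeaf n) : x.seq.length = y.seq.length := by rw [x.length_seq, y.length_seq]
  have hlt (x y : BinLeaf n) : LtRel x y ↔ lexLT x.seq y.seq := by
    constructor
    · rintro ⟨h | h, hne⟩
      · exact absurd h hne
      · exact h
    · intro h
      refine ⟨Or.inr h, ?_⟩
      rintro rfl
      exact h.asymm h
  { lev := fun x y => (meet x.seq y.seq).length
    lev_comm := fun x y => by rw [meet_comm]
    lev_ultra := fun x y z => length_meet_ultra _ _ _
    lev_lt_self := fun x y h => by
      rw [meet_self]
      exact length_meet_lt (hlen x y) fun h' => h (BinLeaf.seq_injective h')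
    le_refl := fun x => Or.inl rfl
    total := fun x y h => by
      rw [hlt, hlt]
      exact lexLT_trichotomy (hlen x y) fun h' => h (BinLeaf.seq_injective h')
    asymm := fun x y => by
      rw [hlt, hlt]
      exact lexLT.asymm
    congr_right := fun x y z h => by
      rw [hlt, hlt]
      exact lexLT.congr_right h
    congr_left := fun x y z h => by
      rw [hlt, hlt]
      exact lexLT.congr_left h
    lev_ne := fun x y z => by
      rw [hlt, hlt]
      exact lexLT.length_meet_ne
    S_iff := fun x y z => by
      rw [hlt, hlt]
      exact Iff.rfl
    R_iff := fun a b c d => by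
      constructor
      · rintro ⟨h1, h2, h3, h4, h5, h6, h⟩
        exact ⟨h1, h2, h3, h4, h5, h6, (arcsDisjoint_iff h1 h6).1 h⟩
      · rintro ⟨h1, h2, h3, h4, h5, h6, h⟩
        exact ⟨h1, h2, h3, h4, h5, h6, (arcsDisjoint_iff h1 h6).2 h⟩ }

/-! ### Transport of the relations and of level functions along embeddings -/

section embeddings

variable {X Y : Type*} [lang.Structure X] [lang.Structure Y]

theorem leRel_map (f : X ↪[lang] Y) {x y : X} : LeRel (f x) (f y) ↔ LeRel x y := by
  have h : f ∘ ![x, y] = ![f x, f y] := by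
    ext i
    fin_cases i <;> rfl
  have := f.map_rel (Rel.le : lang.Relations 2) ![x, y]
  rwa [h] at this

theorem ltRel_map (f : X ↪[lang] Y) {x y : X} : LtRel (f x) (f y) ↔ LtRel x y :=
  and_congr (leRel_map f) f.injective.ne_iff

theorem sRel_map (f : X ↪[lang] Y) {x y z : X} : SRel (f x) (f y) (f z) ↔ SRel x y z := by
  have h : f ∘ ![x, y, z] = ![f x, f y, f z] := by
    ext i
    fin_cases i <;> rfl
  have := f.map_rel (Rel.S : lang.Relations 3) ![x, y, z]
  rwa [h] at this

theorem rRel_map (f : X ↪[lang] Y) {x y z w : X} :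
    RRel (f x) (f y) (f z) (f w) ↔ RRel x y z w := by
  have h : f ∘ ![x, y, z, w] = ![f x, f y, f z, f w] := by
    ext i
    fin_cases i <;> rfl
  have := f.map_rel (Rel.R : lang.Relations 4) ![x, y, z, w]
  rwa [h] at this

theorem cRel_map (f : X ↪[lang] Y) {x y z : X} : CRel (f x) (f y) (f z) ↔ CRel x y z := by
  simp only [CRel, ltRel_map, sRel_map]

theorem ltRel_aut (f : X ≃[lang] Y) {x y : X} : LtRel (f x) (f y) ↔ LtRel x y :=
  ltRel_map f.toEmbedding

theorem cRel_aut (f : X ≃[lang] Y) {x y z : X} : CRel (f x) (f y) (f z) ↔ CRel x y z :=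
  cRel_map f.toEmbedding

/-- Level functions pull back along embeddings. -/
def LevelModel.comap {Λ : Type*} [LinearOrder Λ] (L : LevelModel Y Λ) (f : X ↪[lang] Y) :
    LevelModel X Λ where
  lev x y := L.lev (f x) (f y)
  lev_comm x y := L.lev_comm _ _
  lev_ultra x y z := L.lev_ultra _ _ _
  lev_lt_self x y h := L.lev_lt_self _ _ (f.injective.ne h)
  le_refl x := (leRel_map f).1 (L.le_refl _)
  total x y h := by
    rw [← ltRel_map f, ← ltRel_map f]
    exact L.total _ _ (f.injective.ne h)
  asymm x y := by
    rw [← ltRel_map f, ← ltRel_map f]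
    exact L.asymm _ _
  congr_right x y z h := by
    rw [← ltRel_map f, ← ltRel_map f]
    exact L.congr_right _ _ _ h
  congr_left x y z h := by
    rw [← ltRel_map f, ← ltRel_map f]
    exact L.congr_left _ _ _ h
  lev_ne x y z := by
    rw [← ltRel_map f, ← ltRel_map f]
    exact L.lev_ne _ _ _
  S_iff x y z := by
    rw [← ltRel_map f, ← ltRel_map f, ← sRel_map f]
    exact L.S_iff _ _ _
  R_iff a b c d := by
    rw [← rRel_map f, L.R_iff]
    simp only [f.injective.ne_iff]

end embeddings

/-! ### Calculus of the cone relation in terms of levels -/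

namespace LevelModel

variable {X Λ : Type*} [lang.Structure X] [LinearOrder Λ]

theorem lev_eq (L : LevelModel X Λ) {x y z : X} (h : L.lev x y < L.lev y z) : L.lev x z = L.lev x y := by
  have h1 := L.lev_ultra x y z
  have h2 := L.lev_ultra x z y
  rw [L.lev_comm z y] at h2
  rw [min_eq_left h.le] at h1
  rcases min_le_iff.1 h2 with h2 | h2
  · exact le_antisymm h2 h1
  · exact absurd h (not_lt.2 h2)

theorem lev_le_self (L : LevelModel X Λ) (x y : X) : L.lev x y ≤ L.lev y y := by
  by_cases h : x = y
  · rw [h]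
  · exact (L.lev_lt_self x y h).le

/-- `S` compares levels only when the third point is the largest. This suffices: for `x < y < z` the
levels of `x, y` and of `y, z` differ by binary branching, so the cone avoids `x` exactly when `SRel
x y z` fails. -/
theorem cRel_iff (L : LevelModel X Λ) {x y z : X} : CRel x y z ↔ L.lev x y < L.lev y z := by
  simp only [CRel, L.S_iff]
  constructor
  · rintro (⟨h1, h2, h3⟩ | ⟨h1, h2, h3, h4⟩)
    · rw [L.lev_comm y z] at h3 ⊢
      have h3' : L.lev x z < L.lev z y := by rwa [L.lev_comm x z]
      rwa [L.lev_eq h3']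
    · by_cases hyz : y = z
      · subst hyz
        exact L.lev_lt_self x y h1.2
      · rcases L.total y z hyz with h | h
        · have := L.lev_ne x y z h1 h
          simp only [not_and, not_lt] at h3
          exact lt_of_le_of_ne (h3 h2 h) this
        · have := L.lev_ne x z y h2 h
          simp only [not_and, not_lt] at h4
          have h5 := lt_of_le_of_ne (h4 h1 h) this
          rw [L.lev_eq h5, L.lev_comm y z]
          exact h5
  · intro h
    have hne : x ≠ y := by
      rintro rfl
      have := L.lev_le_self z x
      rw [L.lev_comm z x] at this
      exact absurd h (not_lt.2 this)
    have he := L.lev_eq h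
    rcases L.total x y hne with h1 | h1
    · refine Or.inr ⟨h1, L.congr_right x y z h h1, fun h' => lt_asymm h h'.2.2, fun h' => ?_⟩
      have h3 := h'.2.2
      rw [L.lev_comm z y, he] at h3
      exact lt_asymm h h3
    · exact Or.inl ⟨h1, L.congr_left x y z h h1, by rwa [L.lev_comm z x, he]⟩

theorem sRel_iff_cRel (L : LevelModel X Λ) {x y z : X} : SRel x y z ↔ CRel z x y ∧ LtRel x z := by
  constructor
  · intro h
    exact ⟨Or.inl h, ((L.S_iff _ _ _).1 h).1⟩
  · rintro ⟨h | h, h'⟩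
    · exact h
    · exact absurd h' (L.asymm _ _ h.1)

theorem rRel_iff_cRel (L : LevelModel X Λ) {a b c d : X} : RRel a b c d ↔
    a ≠ b ∧ a ≠ c ∧ a ≠ d ∧ b ≠ c ∧ b ≠ d ∧ c ≠ d ∧
      ((CRel c a b ∧ CRel d a b) ∨ (CRel a c d ∧ CRel b c d)) := by
  simp only [L.R_iff, L.cRel_iff]

theorem leRel_iff (L : LevelModel X Λ) {x y : X} : LeRel x y ↔ x = y ∨ LtRel x y := by
  constructor
  · intro h
    by_cases he : x = y
    · exact Or.inl he
    · exact Or.inr ⟨h, he⟩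
  · rintro (rfl | h)
    · exact L.le_refl x
    · exact h.1

theorem not_ltRel_iff (L : LevelModel X Λ) {x y : X} (h : x ≠ y) : ¬ LtRel x y ↔ LtRel y x :=
  ⟨fun h' => (L.total x y h).resolve_left h', L.asymm y x⟩

theorem ltRel_iff_of_cRel (L : LevelModel X Λ) {x y z : X} (h : CRel x y z) : LtRel x y ↔ LtRel x z := by
  rw [L.cRel_iff] at h
  refine ⟨L.congr_right x y z h, L.congr_right x z y ?_⟩
  rw [L.lev_eq h, L.lev_comm z y]
  exact h

theorem ltRel_iff_of_cRel_left (L : LevelModel X Λ) {x y z : X} (h : CRel x y z) : LtRel y x ↔ LtRel z x := by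
  rw [L.cRel_iff] at h
  refine ⟨L.congr_left x y z h, L.congr_left x z y ?_⟩
  rw [L.lev_eq h, L.lev_comm z y]
  exact h

theorem cRel_ne (L : LevelModel X Λ) {x y z : X} (h : CRel x y z) : x ≠ y := by
  rintro rfl
  rw [L.cRel_iff, L.lev_comm x z] at h
  exact absurd h (not_lt.2 (L.lev_le_self z x))

theorem cRel_self (L : LevelModel X Λ) {x y : X} (h : x ≠ y) : CRel x y y := L.cRel_iff.2 (L.lev_lt_self x y h)

theorem cRel_swap (L : LevelModel X Λ) {x y z : X} (h : CRel x y z) : CRel x z y := by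
  rw [L.cRel_iff] at h ⊢
  rwa [L.lev_eq h, L.lev_comm z y]

theorem cRel_asymm (L : LevelModel X Λ) {x y z : X} (h : CRel x y z) : ¬ CRel y x z := by
  intro h'
  rw [L.cRel_iff] at h h'
  rw [L.lev_eq h, L.lev_comm y x] at h'
  exact lt_irrefl _ h'

theorem cRel_swap_iff (L : LevelModel X Λ) {x y z : X} : CRel x y z ↔ CRel x z y :=
  ⟨L.cRel_swap, L.cRel_swap⟩

/-- In the following lemmas `m` branches off from `b`. A point `x` is far if it leaves the branch of
`b` below `m`, so that it has the same level with `m` as with `b`; it is near if it leaves that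
branch above `m`, so that `m` has the same level with `x` as with `b`. These cases determine every
instance of `CRel` involving `m`. -/
theorem lev_eq_of_far (L : LevelModel X Λ) {m b x : X} (h : CRel x m b) :
    L.lev x m = L.lev x b ∧ L.lev x b < L.lev m b := by
  rw [L.cRel_iff] at h
  have := L.lev_eq h
  exact ⟨this.symm, this ▸ h⟩

theorem lev_eq_of_near (L : LevelModel X Λ) {m b x : X} (h : CRel m x b) :
    L.lev x m = L.lev m b ∧ L.lev m b < L.lev x b := by
  rw [L.cRel_iff] at h
  have := L.lev_eq h
  exact ⟨(L.lev_comm x m).trans this.symm, this ▸ h⟩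

theorem cRel_iff_of_far (L : LevelModel X Λ) {m b x y : X} (hx : CRel x m b) :
    CRel m x y ↔ CRel b x y := by
  rw [L.cRel_iff, L.cRel_iff, L.lev_comm m x, L.lev_comm b x, (L.lev_eq_of_far hx).1]

theorem cRel_of_near_of_near (L : LevelModel X Λ) {m b x y : X} (hx : CRel m x b)
    (hy : CRel m y b) : CRel m x y := by
  have hx' := L.lev_eq_of_near hx
  have hy' := L.lev_eq_of_near hy
  rw [L.cRel_iff, L.lev_comm m x, hx'.1]
  refine lt_of_lt_of_le (lt_min hx'.2 hy'.2) ?_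
  rw [L.lev_comm y b]
  exact L.lev_ultra x b y

theorem not_cRel_of_near_of_far (L : LevelModel X Λ) {m b x y : X} (hx : CRel m x b)
    (hy : CRel y m b) : ¬ CRel m x y := by
  have hx' := L.lev_eq_of_near hx
  have hy' := L.lev_eq_of_far hy
  intro h
  replace h := L.lev_eq (L.cRel_iff.1 h)
  rw [L.lev_comm m y, L.lev_comm m x] at h
  order

theorem cRel_iff_of_far_of_far (L : LevelModel X Λ) {m b x y : X} (hx : CRel x m b)
    (hy : CRel y m b) : CRel x m y ↔ CRel x b y := by
  rw [L.cRel_iff, L.cRel_iff, (L.lev_eq_of_far hx).1, L.lev_comm m y, L.lev_comm b y,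
    (L.lev_eq_of_far hy).1]

theorem cRel_of_far_of_near (L : LevelModel X Λ) {m b x y : X} (hx : CRel x m b)
    (hy : CRel m y b) : CRel x m y := by
  have hx' := L.lev_eq_of_far hx
  have hy' := L.lev_eq_of_near hy
  rw [L.cRel_iff, L.lev_comm m y]
  order

theorem not_cRel_of_near (L : LevelModel X Λ) {m b x y : X} (hx : CRel m x b)
    (hy : CRel y m b ∨ CRel m y b) : ¬ CRel x m y := by
  have hx' := L.lev_eq_of_near hx
  rw [L.cRel_iff, L.lev_comm m y, not_lt]
  rcases hy with hy | hy
  · have hy' := L.lev_eq_of_far hy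
    order
  · have hy' := L.lev_eq_of_near hy
    order

end LevelModel

/-! ### Maps preserving the order and the cones -/

section preserving

variable {X Y Λ Λ' : Type*} [lang.Structure X] [lang.Structure Y] [LinearOrder Λ] [LinearOrder Λ']

/-- `f` preserves and reflects the strict order and the cones on `P`. -/
def Preserves (P : Set X) (f : X → Y) : Prop :=
  (∀ x ∈ P, ∀ y ∈ P, LtRel x y ↔ LtRel (f x) (f y)) ∧
  ∀ x ∈ P, ∀ y ∈ P, ∀ z ∈ P, CRel x y z ↔ CRel (f x) (f y) (f z)

theorem Preserves.mono {P Q : Set X} {f : X → Y} (h : Preserves Q f) (hPQ : P ⊆ Q) :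
    Preserves P f :=
  ⟨fun x hx y hy => h.1 x (hPQ hx) y (hPQ hy),
    fun x hx y hy z hz => h.2 x (hPQ hx) y (hPQ hy) z (hPQ hz)⟩

theorem Preserves.congr {P : Set X} {f g : X → Y} (h : Preserves P f) (hfg : ∀ x ∈ P, f x = g x) :
    Preserves P g := by
  refine ⟨fun x hx y hy => ?_, fun x hx y hy z hz => ?_⟩
  · rw [← hfg x hx, ← hfg y hy]
    exact h.1 x hx y hy
  · rw [← hfg x hx, ← hfg y hy, ← hfg z hz]
    exact h.2 x hx y hy z hz

theorem Preserves.of_equiv (P : Set X) (f : X ≃[lang] Y) : Preserves P f :=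
  ⟨fun _ _ _ _ => (ltRel_aut f).symm, fun _ _ _ _ _ _ => (cRel_aut f).symm⟩

/-- A map preserving order and cones is an embedding. -/
def embeddingOfPreserves (L : LevelModel X Λ) (L' : LevelModel Y Λ') (f : X → Y)
    (h : Preserves Set.univ f) : X ↪[lang] Y :=
  have hlt (x y : X) : LtRel (f x) (f y) ↔ LtRel x y := (h.1 x trivial y trivial).symm
  have hC (x y z : X) : CRel (f x) (f y) (f z) ↔ CRel x y z :=
    (h.2 x trivial y trivial z trivial).symm
  have hinj : Function.Injective f := by
    intro x y hxy
    by_contra hne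
    rcases L.total x y hne with h' | h'
    · exact ((hlt _ _).2 h').2 hxy
    · exact ((hlt _ _).2 h').2 hxy.symm
  { toFun := f
    inj' := hinj
    map_fun' := fun g => isEmptyElim g
    map_rel' := by
      intro n r v
      cases r with
      | R =>
        have hv : v = ![v 0, v 1, v 2, v 3] := by
          ext i
          fin_cases i <;> rfl
        have hv' : f ∘ v = ![f (v 0), f (v 1), f (v 2), f (v 3)] := by
          ext i
          fin_cases i <;> rfl
        rw [hv', hv]
        change RRel _ _ _ _ ↔ RRel _ _ _ _
        rw [L.rRel_iff_cRel, L'.rRel_iff_cRel]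
        simp only [hC, hinj.ne_iff]
        rfl
      | S =>
        have hv : v = ![v 0, v 1, v 2] := by
          ext i
          fin_cases i <;> rfl
        have hv' : f ∘ v = ![f (v 0), f (v 1), f (v 2)] := by
          ext i
          fin_cases i <;> rfl
        rw [hv', hv]
        change SRel _ _ _ ↔ SRel _ _ _
        rw [L.sRel_iff_cRel, L'.sRel_iff_cRel]
        simp only [hC, hlt]
        rfl
      | le =>
        have hv : v = ![v 0, v 1] := by
          ext i
          fin_cases i <;> rfl
        have hv' : f ∘ v = ![f (v 0), f (v 1)] := by
          ext i
          fin_cases i <;> rfl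
        rw [hv', hv]
        change LeRel _ _ ↔ LeRel _ _
        rw [L.leRel_iff, L'.leRel_iff]
        simp only [hlt, hinj.eq_iff]
        rfl }

/-- Every subset carries a substructure, as the language is relational. -/
def subOf (P : Set X) : lang.Substructure X where
  carrier := P
  fun_mem := fun f => isEmptyElim f

theorem subOf_fg {P : Set X} (hP : P.Finite) : (subOf P).FG :=
  Substructure.fg_iff_finite.2 hP

/-- The restriction of a map preserving order and cones on the substructure `S`. -/
def restrictEmbedding (L : LevelModel X Λ) (L' : LevelModel Y Λ') (S : lang.Substructure X)
    (f : X → Y) (h : Preserves (S : Set X) f) : S ↪[lang] Y :=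
  embeddingOfPreserves (L.comap S.subtype) L' (fun x => f x)
    ⟨fun x _ y _ => (ltRel_map S.subtype).symm.trans (h.1 x x.2 y y.2),
      fun x _ y _ z _ => (cRel_map S.subtype).symm.trans (h.2 x x.2 y y.2 z z.2)⟩

/-- In an ultrahomogeneous structure every finite map preserving order and cones extends to
an automorphism. -/
theorem exists_equiv_of_preserves (L : LevelModel X Λ) (hX : lang.IsUltrahomogeneous X)
    {P : Set X} (hP : P.Finite) {f : X → X} (hf : Preserves P f) :
    ∃ g : X ≃[lang] X, ∀ x ∈ P, g x = f x := by
  obtain ⟨g, hg⟩ := hX (subOf P) (subOf_fg hP) (restrictEmbedding L L (subOf P) f hf)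
  refine ⟨g, fun x hx => ?_⟩
  have := DFunLike.congr_fun hg ⟨x, hx⟩
  exact this.symm

/-- One-point extension along the branch of `b`: a map preserving order and cones on `P ∋ b` still
does so with the additional point `m`, if the branching level of `m` from `b` has the same position
among the points of `P` as that of `f m` from `f b` among the images. -/
theorem Preserves.insert (L : LevelModel X Λ) (L' : LevelModel Y Λ') {P : Set X} {f : X → Y}
    (h : Preserves P f) {b m : X} (hb : b ∈ P) (hlt : LtRel m b ↔ LtRel (f m) (f b))
    (hm : ∀ x ∈ P, (CRel x m b ∧ CRel (f x) (f m) (f b)) ∨ (CRel m x b ∧ CRel (f m) (f x) (f b))) :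
    Preserves (insert m P) f := by
  have hne : ∀ x ∈ P, m ≠ x := by
    intro x hx
    rcases hm x hx with ⟨h, -⟩ | ⟨h, -⟩
    · exact (L.cRel_ne h).symm
    · exact L.cRel_ne h
  have hne' : ∀ x ∈ P, f m ≠ f x := by
    intro x hx
    rcases hm x hx with ⟨-, h⟩ | ⟨-, h⟩
    · exact (L'.cRel_ne h).symm
    · exact L'.cRel_ne h
  have hlt' : LtRel b m ↔ LtRel (f b) (f m) := by
    rw [← L.not_ltRel_iff (hne b hb), ← L'.not_ltRel_iff (hne' b hb), hlt]
  have h1 : ∀ x ∈ P, LtRel m x ↔ LtRel (f m) (f x) := by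
    intro x hx
    rcases hm x hx with ⟨h1, h2⟩ | ⟨h1, h2⟩
    · rw [L.ltRel_iff_of_cRel_left h1, L'.ltRel_iff_of_cRel_left h2]
      exact h.1 b hb x hx
    · rw [L.ltRel_iff_of_cRel h1, L'.ltRel_iff_of_cRel h2]
      exact hlt
  have h1' : ∀ x ∈ P, LtRel x m ↔ LtRel (f x) (f m) := by
    intro x hx
    rcases hm x hx with ⟨h1, h2⟩ | ⟨h1, h2⟩
    · rw [L.ltRel_iff_of_cRel h1, L'.ltRel_iff_of_cRel h2]
      exact h.1 x hx b hb
    · rw [L.ltRel_iff_of_cRel_left h1, L'.ltRel_iff_of_cRel_left h2]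
      exact hlt'
  have h2 : ∀ x ∈ P, ∀ y ∈ P, CRel m x y ↔ CRel (f m) (f x) (f y) := by
    intro x hx y hy
    rcases hm x hx with ⟨h1, h2⟩ | ⟨h1, h2⟩
    · rw [L.cRel_iff_of_far h1, L'.cRel_iff_of_far h2]
      exact h.2 b hb x hx y hy
    · rcases hm y hy with ⟨h3, h4⟩ | ⟨h3, h4⟩
      · exact iff_of_false (L.not_cRel_of_near_of_far h1 h3) (L'.not_cRel_of_near_of_far h2 h4)
      · exact iff_of_true (L.cRel_of_near_of_near h1 h3) (L'.cRel_of_near_of_near h2 h4)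
  have h3 : ∀ x ∈ P, ∀ y ∈ P, CRel x m y ↔ CRel (f x) (f m) (f y) := by
    intro x hx y hy
    rcases hm x hx with ⟨h1, h2⟩ | ⟨h1, h2⟩
    · rcases hm y hy with ⟨h3, h4⟩ | ⟨h3, h4⟩
      · rw [L.cRel_iff_of_far_of_far h1 h3, L'.cRel_iff_of_far_of_far h2 h4]
        exact h.2 x hx b hb y hy
      · exact iff_of_true (L.cRel_of_far_of_near h1 h3) (L'.cRel_of_far_of_near h2 h4)
    · exact iff_of_false (L.not_cRel_of_near h1 ((hm y hy).imp And.left And.left))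
        (L'.not_cRel_of_near h2 ((hm y hy).imp And.right And.right))
  have hself : ∀ x : X, ¬ CRel m m x := fun x h => L.cRel_ne h rfl
  have hself' : ∀ x : Y, ¬ CRel (f m) (f m) x := fun x h => L'.cRel_ne h rfl
  constructor
  · rintro x (rfl | hx) y (rfl | hy)
    · exact iff_of_false (fun h => h.2 rfl) (fun h => h.2 rfl)
    · exact h1 y hy
    · exact h1' x hx
    · exact h.1 x hx y hy
  · rintro x (rfl | hx) y (rfl | hy) z (rfl | hz)
    · exact iff_of_false (hself _) (hself' _)
    · exact iff_of_false (hself _) (hself' _)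
    · rw [L.cRel_swap_iff, L'.cRel_swap_iff]
      exact iff_of_false (hself _) (hself' _)
    · exact h2 y hy z hz
    · exact iff_of_true (L.cRel_self (hne x hx).symm) (L'.cRel_self (hne' x hx).symm)
    · exact h3 x hx z hz
    · rw [L.cRel_swap_iff, L'.cRel_swap_iff]
      exact h3 x hx y hy
    · exact h.2 x hx y hy z hz

end preserving

/-! ### A concrete universal ordered boron tree -/

/-- A dense and codense colouring of the rationals: the dyadic rationals are `true`. -/
noncomputable def color (q : ℚ) : Bool := by
  classical exact decide (∃ (z : ℤ) (k : ℕ), q * 2 ^ k = z)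

theorem color_eq_true {q : ℚ} : color q = true ↔ ∃ (z : ℤ) (k : ℕ), q * 2 ^ k = z := by
  simp [color]

theorem exists_dyadic_btwn {x y : ℚ} (h : x < y) : ∃ q, x < q ∧ q < y ∧ color q = true := by
  obtain ⟨k, hk⟩ := pow_unbounded_of_one_lt (1 / (y - x)) (one_lt_two (α := ℚ))
  have h2 : (0 : ℚ) < 2 ^ k := by positivity
  have hk' : 1 < 2 ^ k * (y - x) := by rwa [div_lt_iff₀ (sub_pos.2 h)] at hk
  refine ⟨(⌊x * 2 ^ k⌋ + 1 : ℤ) / 2 ^ k, ?_, ?_, color_eq_true.2 ⟨⌊x * 2 ^ k⌋ + 1, k, ?_⟩⟩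
  · rw [lt_div_iff₀ h2]
    push_cast
    exact Int.lt_floor_add_one _
  · rw [div_lt_iff₀ h2]
    push_cast
    have := Int.floor_le (x * 2 ^ k)
    linarith
  · field_simp

/-- If both numbers were dyadic, clearing denominators would make 3 divide a power of 2. So a
translate of the dyadic rationals is a dense set of the other colour. -/
theorem color_add_third {q : ℚ} (h : color q = true) : color (q + 1 / 3) = false := by
  by_contra hne
  rw [Bool.not_eq_false, color_eq_true] at hne
  rw [color_eq_true] at h
  obtain ⟨z, k, hz⟩ := h
  obtain ⟨w, l, hw⟩ := hne
  have h1 : (3 * (w * 2 ^ k - z * 2 ^ l) : ℚ) = 2 ^ (k + l) := by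
    rw [← hz, ← hw, pow_add]
    ring
  have h2 : 3 * (w * 2 ^ k - z * 2 ^ l) = (2 : ℤ) ^ (k + l) := by exact_mod_cast h1
  have h3 : (3 : ℤ) ∣ 2 ^ (k + l) := ⟨_, h2.symm⟩
  have h4 := Int.Prime.dvd_pow' Nat.prime_three h3
  norm_num at h4

theorem exists_color_btwn {x y : ℚ} (h : x < y) (c : Bool) : ∃ q, x < q ∧ q < y ∧ color q = c := by
  cases c
  · obtain ⟨q, h1, h2, h3⟩ := exists_dyadic_btwn (sub_lt_sub_right h (1 / 3))
    exact ⟨q + 1 / 3, by linarith, by linarith, color_add_third h3⟩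
  · exact exists_dyadic_btwn h

/-- Between two finite sets of levels there is a level of prescribed colour avoiding a
finite set. -/
theorem exists_level_btwn (lo hi : Finset (WithTop ℚ)) (htop : ∀ a ∈ lo, a ≠ ⊤)
    (h : ∀ a ∈ lo, ∀ b ∈ hi, a < b) (F : Finset ℚ) (c : Bool) :
    ∃ q : ℚ, (∀ a ∈ lo, a < q) ∧ (∀ b ∈ hi, (q : WithTop ℚ) < b) ∧ q ∉ F ∧ color q = c := by
  have hinj : Function.Injective (WithTop.some : ℚ → WithTop ℚ) := WithTop.coe_injective
  let lo' : Finset ℚ := lo.preimage WithTop.some hinj.injOn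
  let hi' : Finset ℚ := hi.preimage WithTop.some hinj.injOn
  obtain ⟨m, hm1, hm2⟩ := Order.exists_between_finsets lo' hi' (fun x hx y hy =>
    WithTop.coe_lt_coe.1 (h x (Finset.mem_preimage.1 hx) y (Finset.mem_preimage.1 hy)))
  -- The interval is shortened to `(m, m')`, which contains no point of `F`.
  obtain ⟨m', hm1', hm2'⟩ := Order.exists_between_finsets {m} (hi' ∪ F.filter (m < ·)) (by
    intro x hx y hy
    rw [Finset.mem_singleton] at hx
    subst hx
    rcases Finset.mem_union.1 hy with hy | hy
    · exact hm2 y hy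
    · exact (Finset.mem_filter.1 hy).2)
  obtain ⟨q, hq1, hq2, hq3⟩ := exists_color_btwn (hm1' m (Finset.mem_singleton_self m)) c
  refine ⟨q, fun a ha => ?_, fun b hb => ?_, fun hF => ?_, hq3⟩
  · lift a to ℚ using htop a ha
    exact WithTop.coe_lt_coe.2 ((hm1 a (Finset.mem_preimage.2 ha)).trans hq1)
  · induction b using WithTop.recTopCoe with
    | top => exact WithTop.coe_lt_top q
    | coe b =>
      exact WithTop.coe_lt_coe.2
        (hq2.trans (hm2' b (Finset.mem_union_left _ (Finset.mem_preimage.2 hb))))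
  · exact lt_asymm hq2 (hm2' q (Finset.mem_union_right _ (Finset.mem_filter.2 ⟨hF, hq1⟩)))

/-- The leaves of the universal ordered boron tree: the maps from the rationals to `{0, 1}` which
differ from the colouring at finitely many places, given by the set of these places. -/
@[ext]
structure UnivTree : Type u where
  flips : Finset ℚ

namespace UnivTree

instance : Countable UnivTree.{u} := 
  Function.Injective.countable (f := UnivTree.flips) fun _ _ => UnivTree.ext

/-- The value of a leaf at a level. -/
noncomputable def bit (x : UnivTree.{u}) (q : ℚ) : Bool := xor (color q) (decide (q ∈ x.flips))

/-- The level at which two leaves branch. -/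
def lev (x y : UnivTree.{u}) : WithTop ℚ := (symmDiff x.flips y.flips).min

/-- The lexicographical order. -/
def lt (x y : UnivTree.{u}) : Prop := ∃ q : ℚ, lev x y = q ∧ x.bit q = false ∧ y.bit q = true

theorem mem_symmDiff_iff {x y : UnivTree.{u}} {q : ℚ} :
    q ∈ symmDiff x.flips y.flips ↔ x.bit q ≠ y.bit q := by
  rw [Finset.mem_symmDiff, bit, bit]
  by_cases h1 : q ∈ x.flips <;> by_cases h2 : q ∈ y.flips <;> simp [h1, h2]

theorem bit_ne_of_lev_eq {x y : UnivTree.{u}} {q : ℚ} (h : lev x y = q) : x.bit q ≠ y.bit q :=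
  mem_symmDiff_iff.1 (Finset.mem_of_min h)

theorem bit_eq_of_lt_lev {x y : UnivTree.{u}} {q : ℚ} (h : (q : WithTop ℚ) < lev x y) :
    x.bit q = y.bit q := by
  by_contra hne
  exact absurd (Finset.min_le (mem_symmDiff_iff.2 hne)) (not_le.2 h)

theorem lev_comm (x y : UnivTree.{u}) : lev x y = lev y x := by
  rw [lev, lev, symmDiff_comm]

theorem lev_self (x : UnivTree.{u}) : lev x x = ⊤ := by
  simp [lev]

theorem lev_ne_top {x y : UnivTree.{u}} (h : x ≠ y) : lev x y ≠ ⊤ := by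
  rw [lev, Ne, Finset.min_eq_top, ← Finset.bot_eq_empty, symmDiff_eq_bot]
  exact fun h' => h (UnivTree.ext h')

theorem lev_ultra (x y z : UnivTree.{u}) : min (lev x y) (lev y z) ≤ lev x z := by
  refine Finset.le_min fun q hq => ?_
  by_contra! h
  obtain ⟨h1, h2⟩ := lt_min_iff.1 h
  exact mem_symmDiff_iff.1 hq ((bit_eq_of_lt_lev h1).trans (bit_eq_of_lt_lev h2))

theorem lev_eq {x y z : UnivTree.{u}} (h : lev x y < lev y z) : lev x z = lev x y := by
  have h1 := lev_ultra x y z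
  have h2 := lev_ultra x z y
  rw [lev_comm z y] at h2
  rw [min_eq_left h.le] at h1
  rcases min_le_iff.1 h2 with h2 | h2
  · exact le_antisymm h2 h1
  · exact absurd h (not_lt.2 h2)

/-- `R` and `S` are given by the level inequalities that characterise them in `B_n`. -/
noncomputable instance : lang.Structure UnivTree.{u} where
  funMap := fun f _ => Empty.elim f
  RelMap := fun {_} r =>
    match r with
    | Rel.R => fun v => v 0 ≠ v 1 ∧ v 0 ≠ v 2 ∧ v 0 ≠ v 3 ∧ v 1 ≠ v 2 ∧ v 1 ≠ v 3 ∧ v 2 ≠ v 3 ∧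
        ((lev (v 2) (v 0) < lev (v 0) (v 1) ∧ lev (v 3) (v 0) < lev (v 0) (v 1)) ∨
          (lev (v 0) (v 2) < lev (v 2) (v 3) ∧ lev (v 1) (v 2) < lev (v 2) (v 3)))
    | Rel.S => fun v => lt (v 0) (v 2) ∧ lt (v 1) (v 2) ∧ lev (v 1) (v 2) < lev (v 0) (v 1)
    | Rel.le => fun v => v 0 = v 1 ∨ lt (v 0) (v 1)

theorem lt_asymm {x y : UnivTree.{u}} (h : lt x y) : ¬ lt y x := by
  rintro ⟨q, h1, h2, h3⟩
  obtain ⟨q', h1', h2', h3'⟩ := h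
  rw [lev_comm, h1'] at h1
  obtain rfl := WithTop.coe_injective h1
  rw [h2] at h3'
  exact Bool.false_ne_true h3'

theorem ltRel_iff {x y : UnivTree.{u}} : LtRel x y ↔ lt x y := by
  constructor
  · rintro ⟨h | h, hne⟩
    · exact absurd h hne
    · exact h
  · intro h
    refine ⟨Or.inr h, ?_⟩
    intro he
    have h' : lt x x := by
      have h2 := h
      rwa [← show x = y from he] at h2
    exact lt_asymm h' h'

/-- The branching levels form a level function. -/
def levelModel : LevelModel UnivTree.{u} (WithTop ℚ) where
  lev := lev
  lev_comm := lev_comm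
  lev_ultra := lev_ultra
  lev_lt_self x y h := by
    rw [lev_self]
    exact lt_top_iff_ne_top.2 (lev_ne_top h)
  le_refl x := Or.inl rfl
  total x y h := by
    rw [ltRel_iff, ltRel_iff]
    obtain ⟨q, hq⟩ := WithTop.ne_top_iff_exists.1 (lev_ne_top h)
    have hne := bit_ne_of_lev_eq hq.symm
    cases hx : x.bit q <;> cases hy : y.bit q
    · exact absurd (hx.trans hy.symm) hne
    · exact Or.inl ⟨q, hq.symm, hx, hy⟩
    · exact Or.inr ⟨q, (lev_comm _ _).trans hq.symm, hy, hx⟩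
    · exact absurd (hx.trans hy.symm) hne
  asymm x y := by
    rw [ltRel_iff, ltRel_iff]
    exact lt_asymm
  congr_right x y z h := by
    rw [ltRel_iff, ltRel_iff]
    rintro ⟨q, hq, h1, h2⟩
    refine ⟨q, (lev_eq h).trans hq, h1, ?_⟩
    rw [← bit_eq_of_lt_lev (hq ▸ h), h2]
  congr_left x y z h := by
    rw [ltRel_iff, ltRel_iff]
    rintro ⟨q, hq, h1, h2⟩
    rw [lev_comm] at hq
    refine ⟨q, (lev_comm z x).trans ((lev_eq h).trans hq), ?_, h2⟩
    rw [← bit_eq_of_lt_lev (hq ▸ h), h1]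
  lev_ne x y z := by
    rw [ltRel_iff, ltRel_iff]
    rintro ⟨q, hq, -, h1⟩ ⟨q', hq', h2, -⟩ he
    rw [hq, hq'] at he
    obtain rfl := WithTop.coe_injective he
    rw [h2] at h1
    exact Bool.false_ne_true h1
  S_iff x y z := by
    rw [ltRel_iff, ltRel_iff]
    exact Iff.rfl
  R_iff a b c d := Iff.rfl

end UnivTree

/-- Binary branching again: otherwise the three points `m`, `x`, `b` would branch pairwise at one
level, and in every arrangement of the order two consecutive comparisons contradict `lev_ne`. -/
theorem LevelModel.lev_lt_of_lev_eq {X Λ : Type*} [lang.Structure X] [LinearOrder Λ]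
    (L : LevelModel X Λ) {m x b : X} (hx : m ≠ x) (hb : m ≠ b) (h : L.lev m x = L.lev m b) :
    L.lev m b < L.lev x b := by
  by_cases hxb : x = b
  · subst hxb
    exact L.lev_lt_self m x hx
  · have h1 := L.lev_ultra x m b
    rw [L.lev_comm x m, h, min_self] at h1
    refine lt_of_le_of_ne h1 fun h2 => ?_
    have c1 := L.lev_comm x m
    have c2 := L.lev_comm b m
    have c3 := L.lev_comm b x
    rcases L.total m x hx with h3 | h3 <;> rcases L.total m b hb with h4 | h4 <;>
      rcases L.total x b hxb with h5 | h5
    · exact L.lev_ne _ _ _ h3 h5 (by order)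
    · exact L.lev_ne _ _ _ h4 h5 (by order)
    · exact L.lev_ne _ _ _ h4 h3 (by order)
    · exact L.lev_ne _ _ _ h4 h3 (by order)
    · exact L.lev_ne _ _ _ h3 h4 (by order)
    · exact L.lev_ne _ _ _ h3 h4 (by order)
    · exact L.lev_ne _ _ _ h5 h4 (by order)
    · exact L.lev_ne _ _ _ h5 h3 (by order)

section extension

variable {X Λ : Type*} [lang.Structure X] [LinearOrder Λ]

/-- Finite maps to the universal ordered boron tree extend to one more point. -/
theorem exists_preserves_insert (L : LevelModel X Λ) {P : Set X} (hP : P.Finite)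
    {f : X → UnivTree.{u}} (hf : Preserves P f) {m : X} (hm : m ∉ P) :
    ∃ g : X → UnivTree.{u}, (∀ x ∈ P, g x = f x) ∧ Preserves (insert m P) g := by
  classical
  let U := UnivTree.levelModel.{u}
  rcases P.eq_empty_or_nonempty with rfl | hne
  · refine ⟨f, fun _ _ => rfl, ?_⟩
    have hm' : ∀ x ∈ insert m (∅ : Set X), x = m := by simp
    refine ⟨fun x hx y hy => ?_, fun x hx y hy z hz => ?_⟩
    · rw [hm' x hx, hm' y hy]
      exact iff_of_false (fun h => h.2 rfl) (fun h => h.2 rfl)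
    · rw [hm' x hx, hm' y hy, hm' z hz]
      exact iff_of_false (fun h => L.cRel_ne h rfl) (fun h => U.cRel_ne h rfl)
  -- With `b` a point of `P` sharing the longest branch with `m`, every point of `P` is far or near
  -- in relation to `m` and `b`.
  obtain ⟨b, hb, hmax⟩ := Set.exists_max_image P (L.lev m) hP hne
  have hmne : ∀ x ∈ P, m ≠ x := fun x hx h => hm (h ▸ hx)
  have hcases : ∀ x ∈ P, CRel x m b ∨ CRel m x b := by
    intro x hx
    rcases (hmax x hx).lt_or_eq with h | h
    · left
      rwa [L.cRel_iff, L.lev_comm x m]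
    · right
      rw [L.cRel_iff, h]
      exact L.lev_lt_of_lev_eq (hmne x hx) (hmne b hb) h
  let lo : Finset (WithTop ℚ) := (hP.toFinset.filter (fun x => CRel x m b)).image
    fun x => U.lev (f x) (f b)
  let hi : Finset (WithTop ℚ) := (hP.toFinset.filter (fun x => CRel m x b)).image
    fun x => U.lev (f x) (f b)
  have hlohi : ∀ a ∈ lo, ∀ c ∈ hi, a < c := by
    intro a ha c hc
    obtain ⟨x, hx, rfl⟩ := Finset.mem_image.1 ha
    obtain ⟨y, hy, rfl⟩ := Finset.mem_image.1 hc
    obtain ⟨hxP, hx⟩ := Finset.mem_filter.1 hx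
    obtain ⟨hyP, hy⟩ := Finset.mem_filter.1 hy
    rw [Set.Finite.mem_toFinset] at hxP hyP
    have h1 := L.lev_eq_of_far hx
    have h2 := L.lev_eq_of_near hy
    have h3 : CRel x b y := by
      rw [L.cRel_iff, L.lev_comm b y]
      exact h1.2.trans h2.2
    rw [hf.2 x hxP b hb y hyP, U.cRel_iff, U.lev_comm (f b) (f y)] at h3
    exact h3
  -- The point `b` is itself near, at level `⊤`; hence no level in `lo` is `⊤`.
  have hbhi : U.lev (f b) (f b) ∈ hi :=
    Finset.mem_image.2 ⟨b, Finset.mem_filter.2 ⟨hP.mem_toFinset.2 hb, L.cRel_self (hmne b hb)⟩, rfl⟩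
  -- The new leaf is `f b` flipped at the single level `q`. As `q` is not yet flipped in `f b`, the
  -- bit of `f b` there is the colour, which must be 1 exactly when `m < b`.
  obtain ⟨q, hq1, hq2, hq3, hq4⟩ := exists_level_btwn lo hi
    (fun a ha => ne_top_of_lt (hlohi a ha _ hbhi)) hlohi (f b).flips (decide (LtRel m b))
  let y : UnivTree.{u} := ⟨symmDiff (f b).flips {q}⟩
  have hlev : U.lev (f b) y = q := by
    change (symmDiff (f b).flips (symmDiff (f b).flips {q})).min = q
    rw [symmDiff_symmDiff_cancel_left, Finset.min_singleton]
  have hbit : (f b).bit q = decide (LtRel m b) := by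
    simp [UnivTree.bit, hq3, hq4]
  have hbit' := UnivTree.bit_ne_of_lev_eq hlev
  have hlt : LtRel m b ↔ LtRel y (f b) := by
    rw [UnivTree.ltRel_iff]
    constructor
    · intro h
      refine ⟨q, (UnivTree.lev_comm _ _).trans hlev, ?_, by simpa [h] using hbit⟩
      simpa [hbit, h] using hbit'
    · rintro ⟨q', h1, h2, h3⟩
      rw [UnivTree.lev_comm] at h1
      obtain rfl := WithTop.coe_injective (h1.symm.trans hlev)
      simpa [hbit] using h3
  refine ⟨Function.update f m y, fun x hx => Function.update_of_ne (hmne x hx).symm _ _, ?_⟩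
  have hfx : ∀ x ∈ P, f x = Function.update f m y x := fun x hx =>
    (Function.update_of_ne (hmne x hx).symm _ _).symm
  refine (hf.congr hfx).insert L U hb ?_ ?_
  · rwa [Function.update_self, ← hfx b hb]
  · intro x hx
    rw [Function.update_self, ← hfx b hb, ← hfx x hx]
    refine (hcases x hx).imp (fun h => ⟨h, ?_⟩) (fun h => ⟨h, ?_⟩)
    · refine U.cRel_swap (U.cRel_iff.2 ?_)
      rw [hlev]
      exact hq1 _ (Finset.mem_image.2 ⟨x, Finset.mem_filter.2 ⟨hP.mem_toFinset.2 hx, h⟩, rfl⟩)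
    · refine U.cRel_swap (U.cRel_iff.2 ?_)
      rw [U.lev_comm y, hlev, U.lev_comm (f b)]
      exact hq2 _ (Finset.mem_image.2 ⟨x, Finset.mem_filter.2 ⟨hP.mem_toFinset.2 hx, h⟩, rfl⟩)

/-- Every finite structure with a level function embeds in the universal ordered boron tree. -/
theorem nonempty_embedding_univTree [Finite X] (L : LevelModel X Λ) :
    Nonempty (X ↪[lang] UnivTree.{u}) := by
  have key : ∀ P : Set X, P.Finite → ∃ f : X → UnivTree.{u}, Preserves P f := by
    intro P hP
    induction P, hP using Set.Finite.induction_on with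
    | empty => exact ⟨fun _ => ⟨∅⟩, by simp [Preserves]⟩
    | @insert m P hm hP ih =>
      obtain ⟨f, hf⟩ := ih
      obtain ⟨g, -, hg⟩ := exists_preserves_insert L hP hf hm
      exact ⟨g, hg⟩
  obtain ⟨f, hf⟩ := key Set.univ Set.finite_univ
  exact ⟨embeddingOfPreserves L UnivTree.levelModel f hf⟩

end extension

/-- By countability, back and forth reduces this to the extension of finite maps by one point, which
is `exists_preserves_insert`. -/
theorem univTree_isUltrahomogeneous : lang.IsUltrahomogeneous UnivTree.{u} := by
  classical
  let U := UnivTree.levelModel.{u}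
  rw [isUltrahomogeneous_iff_IsExtensionPair Structure.cg_of_countable,
    isExtensionPair_iff_exists_embedding_closure_singleton_sup]
  intro S hS f m
  have hfin : (S : Set UnivTree.{u}).Finite := Substructure.fg_iff_finite.1 hS
  let F : UnivTree.{u} → UnivTree.{u} := fun x => if h : x ∈ S then f ⟨x, h⟩ else x
  have hF : ∀ x : S, F x = f x := fun x => dif_pos x.2
  have hpres : Preserves (S : Set UnivTree.{u}) F := by
    refine ⟨fun x hx y hy => ?_, fun x hx y hy z hz => ?_⟩
    · rw [hF ⟨x, hx⟩, hF ⟨y, hy⟩, ltRel_map]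
      exact ltRel_map S.subtype (x := ⟨x, hx⟩) (y := ⟨y, hy⟩)
    · rw [hF ⟨x, hx⟩, hF ⟨y, hy⟩, hF ⟨z, hz⟩, cRel_map]
      exact cRel_map S.subtype (x := ⟨x, hx⟩) (y := ⟨y, hy⟩) (z := ⟨z, hz⟩)
  obtain ⟨g, hg1, hg2⟩ : ∃ g : UnivTree.{u} → UnivTree.{u}, (∀ x ∈ (S : Set UnivTree.{u}), g x = F x) ∧
      Preserves (insert m (S : Set UnivTree.{u})) g := by
    by_cases hm : m ∈ (S : Set UnivTree.{u})
    · exact ⟨F, fun _ _ => rfl, by rwa [Set.insert_eq_of_mem hm]⟩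
    · exact exists_preserves_insert U hfin hpres hm
  have hle : (Substructure.closure lang {m} ⊔ S) ≤ subOf (insert m (S : Set UnivTree.{u})) := by
    refine sup_le ?_ ?_
    · rw [Substructure.closure_le]
      rintro x rfl
      exact Or.inl rfl
    · exact fun x hx => Or.inr hx
  refine ⟨restrictEmbedding U U _ g (hg2.mono hle), ?_⟩
  refine DFunLike.ext _ _ fun x => ?_
  exact (hF x).symm.trans (hg1 x x.2).symm

/-! ### The age of the universal ordered boron tree -/

theorem meet_map_append {α : Type*} (f g : α → Bool) (l₁ l₂ : List α) (q : α)
    (h : ∀ x ∈ l₁, f x = g x) (hq : f q ≠ g q) :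
    meet ((l₁ ++ q :: l₂).map f) ((l₁ ++ q :: l₂).map g) = l₁.map f := by
  induction l₁ with
  | nil => simp [meet, hq]
  | cons a l ih =>
    have ha := h a (by simp)
    have := ih fun x hx => h x (by simp [hx])
    simpa [meet, ha] using this

/-- Finitely many leaves branch only at flipped levels. Reading their bits along a finite set `Q`
containing these levels gives binary sequences; the meet of two of them has as length the number of
elements of `Q` below the branching level. -/
theorem exists_embedding_binLeaf (P : Finset UnivTree.{u}) :
    ∃ (n : ℕ) (f : UnivTree.{u} → BinLeaf n), Preserves (P : Set UnivTree.{u}) f := by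
  classical
  let U := UnivTree.levelModel.{u}
  -- The levels 0 and 1 only ensure length at least 2, as `exists_binLeaf` requires.
  let Q : Finset ℚ := P.sup (fun x => x.flips) ∪ {0, 1}
  let l : List ℚ := Q.sort (· ≤ ·)
  have hl : l.SortedLT := Finset.sortedLT_sort Q
  have hlen : l.length = Q.card := Finset.length_sort _
  have h2 : 2 ≤ l.length := by
    rw [hlen]
    calc 2 = ({0, 1} : Finset ℚ).card := by simp
      _ ≤ Q.card := Finset.card_le_card Finset.subset_union_right
  have hex : ∀ x : UnivTree.{u}, ∃ a : BinLeaf (l.length + 1), a.seq = l.map x.bit := fun x =>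
    exists_binLeaf _ (by simpa using h2) (by simp)
  choose f hf using hex
  refine ⟨l.length + 1, f, ?_⟩
  have hQ : ∀ x ∈ P, ∀ y ∈ P, ∀ q : ℚ, UnivTree.lev x y = q → q ∈ Q := by
    intro x hx y hy q hq
    have := Finset.mem_of_min hq
    rw [Finset.mem_symmDiff] at this
    refine Finset.mem_union_left _ (Finset.mem_sup.2 ?_)
    rcases this with h | h
    · exact ⟨x, hx, h.1⟩
    · exact ⟨y, hy, h.1⟩
  have hdec : ∀ x y : UnivTree.{u}, ∀ q : ℚ, UnivTree.lev x y = q → q ∈ Q →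
      ∃ l₁ l₂, l = l₁ ++ q :: l₂ ∧ (∀ p ∈ l₁, x.bit p = y.bit p) ∧
        l₁.length = (Q.filter (fun p : ℚ => (p : WithTop ℚ) < UnivTree.lev x y)).card := by
    intro x y q hq hqQ
    obtain ⟨l₁, l₂, h⟩ := List.append_of_mem ((Finset.mem_sort (· ≤ ·)).2 hqQ)
    have hs : (l₁ ++ q :: l₂).Pairwise (· < ·) := by
      rw [← h]
      exact hl.pairwise
    rw [List.pairwise_append, List.pairwise_cons] at hs
    have hlt : ∀ p ∈ l₁, p < q := fun p hp => hs.2.2 p hp q (by simp)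
    refine ⟨l₁, l₂, h, fun p hp => UnivTree.bit_eq_of_lt_lev ?_, ?_⟩
    · rw [hq]
      exact WithTop.coe_lt_coe.2 (hlt p hp)
    · have hnd : l₁.Nodup := by
        have : (l₁ ++ q :: l₂).Nodup := by
          rw [← h]
          exact Finset.sort_nodup _ _
        exact (List.nodup_append.1 this).1
      rw [← List.toFinset_card_of_nodup hnd]
      congr 1
      ext p
      rw [List.mem_toFinset, Finset.mem_filter, hq, WithTop.coe_lt_coe, ← Finset.mem_sort (· ≤ ·)]
      change _ ↔ p ∈ l ∧ _
      rw [show l = l₁ ++ q :: l₂ from h, List.mem_append, List.mem_cons]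
      constructor
      · exact fun hp => ⟨Or.inl hp, hlt p hp⟩
      · rintro ⟨hp | rfl | hp, hpq⟩
        · exact hp
        · exact absurd hpq (lt_irrefl _)
        · exact absurd hpq (not_lt.2 (hs.2.1.1 p hp).le)
  have hcard : ∀ x ∈ P, ∀ y ∈ P, (meet (f x).seq (f y).seq).length =
      (Q.filter (fun p : ℚ => (p : WithTop ℚ) < UnivTree.lev x y)).card := by
    intro x hx y hy
    rw [hf, hf]
    by_cases hxy : x = y
    · subst hxy
      rw [meet_self, UnivTree.lev_self, List.length_map, hlen]
      congr 1
      simp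
    · obtain ⟨q, hq⟩ := WithTop.ne_top_iff_exists.1 (UnivTree.lev_ne_top hxy)
      obtain ⟨l₁, l₂, h, h1, h2⟩ := hdec x y q hq.symm (hQ x hx y hy q hq.symm)
      rw [← h2, h, meet_map_append _ _ _ _ _ h1 (UnivTree.bit_ne_of_lev_eq hq.symm),
        List.length_map]
  have hlt : ∀ x ∈ P, ∀ y ∈ P, LtRel x y → LtRel (f x) (f y) := by
    intro x hx y hy h
    obtain ⟨q, hq, hx', hy'⟩ := UnivTree.ltRel_iff.1 h
    obtain ⟨l₁, l₂, h, h1, h2⟩ := hdec x y q hq (hQ x hx y hy q hq)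
    have hlex : lexLT (f x).seq (f y).seq := by
      rw [hf, hf, h]
      refine ⟨l₁.map x.bit, ?_, ?_⟩
      · simp [hx']
      · rw [List.map_congr_left h1]
        simp [hy']
    refine ⟨Or.inr hlex, fun he => ?_⟩
    have hlex' : lexLT (f x).seq (f x).seq := by
      rw [← show f x = f y from he] at hlex
      exact hlex
    exact hlex'.asymm hlex'
  constructor
  · intro x hx y hy
    refine ⟨hlt x hx y hy, fun h => ?_⟩
    by_contra hn
    have hne : x ≠ y := by
      rintro rfl
      exact h.2 rfl
    exact (binLeafLevelModel _).asymm _ _ h (hlt y hy x hx ((U.not_ltRel_iff hne).1 hn))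
  · intro x hx y hy z hz
    rw [U.cRel_iff, (binLeafLevelModel _).cRel_iff]
    change _ ↔ (meet (f x).seq (f y).seq).length < (meet (f y).seq (f z).seq).length
    rw [hcard x hx y hy, hcard y hy z hz]
    change UnivTree.lev x y < UnivTree.lev y z ↔ _
    constructor
    · intro h
      obtain ⟨q, hq⟩ := WithTop.ne_top_iff_exists.1 (ne_top_of_lt h)
      refine Finset.card_lt_card (Finset.ssubset_iff_of_subset ?_ |>.2 ⟨q, ?_, ?_⟩)
      · exact fun p hp => Finset.mem_filter.2
          ⟨(Finset.mem_filter.1 hp).1, (Finset.mem_filter.1 hp).2.trans h⟩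
      · exact Finset.mem_filter.2 ⟨hQ x hx y hy q hq.symm, hq ▸ h⟩
      · rw [Finset.mem_filter, hq]
        exact fun h' => lt_irrefl _ h'.2
    · intro h
      by_contra! hle
      refine absurd h (not_lt.2 (Finset.card_le_card fun p hp => Finset.mem_filter.2
        ⟨(Finset.mem_filter.1 hp).1, (Finset.mem_filter.1 hp).2.trans_le hle⟩))

theorem mem_SB_of_embedding {A : CategoryTheory.Bundled.{u} lang.Structure} [Finite A]
    (f : A ↪[lang] UnivTree.{u}) : A ∈ SB.{u} := by
  refine ⟨inferInstance, ?_⟩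
  obtain ⟨n, g, hg⟩ := exists_embedding_binLeaf (Set.finite_range f).toFinset
  rw [Set.Finite.coe_toFinset] at hg
  refine ⟨n, ⟨embeddingOfPreserves (UnivTree.levelModel.comap f) (binLeafLevelModel n)
    (fun x => g (f x)) ⟨fun x _ y _ => ?_, fun x _ y _ z _ => ?_⟩⟩⟩
  · exact (ltRel_map f).symm.trans (hg.1 _ ⟨x, rfl⟩ _ ⟨y, rfl⟩)
  · exact (cRel_map f).symm.trans (hg.2 _ ⟨x, rfl⟩ _ ⟨y, rfl⟩ _ ⟨z, rfl⟩)

theorem nonempty_embedding_of_mem_SB {A : CategoryTheory.Bundled.{u} lang.Structure}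
    (hA : A ∈ SB.{u}) : Nonempty (A ↪[lang] UnivTree.{u}) := by
  obtain ⟨hfin, n, ⟨f⟩⟩ := hA
  exact nonempty_embedding_univTree ((binLeafLevelModel n).comap f)

theorem univTree_isFraisseLimit : IsFraisseLimit SB.{u} UnivTree.{u} where
  ultrahomogeneous := univTree_isUltrahomogeneous
  age := by
    ext A
    constructor
    · rintro ⟨hfg, ⟨f⟩⟩
      have : Finite A := hfg.finite
      exact mem_SB_of_embedding f
    · intro hA
      have : Finite A := hA.1
      exact ⟨Structure.fg_iff_finite.2 this, nonempty_embedding_of_mem_SB hA⟩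

/-! ### Words in automorphisms -/

section words

variable {ι M : Type*} [lang.Structure M]

/-- The permutation of `M` given by a word in the automorphisms `q i`. -/
def wordPerm (q : ι → (M ≃[lang] M)) : FreeGroup ι →* Equiv.Perm M :=
  FreeGroup.lift fun i => (q i).toEquiv

theorem wordPerm_of (q : ι → (M ≃[lang] M)) (i : ι) (x : M) :
    wordPerm q (FreeGroup.of i) x = q i x := by
  rw [wordPerm, FreeGroup.lift_apply_of]
  rfl

theorem wordPerm_inv_eq_iff (q : ι → (M ≃[lang] M)) (w : FreeGroup ι) (x y : M) :
    wordPerm q w⁻¹ x = y ↔ x = wordPerm q w y := by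
  rw [map_inv, Equiv.Perm.inv_eq_iff_eq]

theorem wordPerm_mul (q : ι → (M ≃[lang] M)) (v w : FreeGroup ι) (x : M) :
    wordPerm q (v * w) x = wordPerm q v (wordPerm q w x) := by
  rw [map_mul, Equiv.Perm.mul_apply]

theorem wordPerm_one (q : ι → (M ≃[lang] M)) (x : M) : wordPerm q 1 x = x := by
  rw [map_one, Equiv.Perm.one_apply]

theorem exists_equiv_wordPerm (q : ι → (M ≃[lang] M)) (w : FreeGroup ι) :
    ∃ h : M ≃[lang] M, ∀ x, wordPerm q w x = h x := by
  induction w using FreeGroup.induction_on with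
  | C1 => exact ⟨Language.Equiv.refl lang M, fun x => wordPerm_one q x⟩
  | of i => exact ⟨q i, fun x => wordPerm_of q i x⟩
  | inv_of i ih =>
    obtain ⟨h, hh⟩ := ih
    refine ⟨h.symm, fun x => ?_⟩
    rw [wordPerm_inv_eq_iff, hh, Language.Equiv.apply_symm_apply]
  | mul v w ihv ihw =>
    obtain ⟨g, hg⟩ := ihv
    obtain ⟨h, hh⟩ := ihw
    exact ⟨g.comp h, fun x => by rw [wordPerm_mul, hh, hg, Language.Equiv.comp_apply]⟩

theorem wordPerm_fixed {q : ι → (M ≃[lang] M)} {b : M} (hb : ∀ i, q i b = b) (w : FreeGroup ι) :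
    wordPerm q w b = b := by
  induction w using FreeGroup.induction_on with
  | C1 => exact wordPerm_one q b
  | of i => rw [wordPerm_of, hb]
  | inv_of i ih => rw [wordPerm_inv_eq_iff, ih]
  | mul v w ihv ihw => rw [wordPerm_mul, ihw, ihv]

/-- The value of a word at a point depends on finitely many values of the automorphisms. -/
theorem exists_finite_wordPerm_eq (q : ι → (M ≃[lang] M)) (w : FreeGroup ι) (x : M) :
    ∃ D : Set M, D.Finite ∧ ∀ r : ι → (M ≃[lang] M), (∀ i, ∀ y ∈ D, r i y = q i y) →
      wordPerm r w x = wordPerm q w x := by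
  induction w using FreeGroup.induction_on generalizing x with
  | C1 => exact ⟨∅, Set.finite_empty, fun r _ => by rw [wordPerm_one, wordPerm_one]⟩
  | of i =>
    refine ⟨{x}, Set.finite_singleton x, fun r hr => ?_⟩
    rw [wordPerm_of, wordPerm_of, hr i x rfl]
  | inv_of i ih =>
    refine ⟨{wordPerm q (FreeGroup.of i)⁻¹ x}, Set.finite_singleton _, fun r hr => ?_⟩
    rw [wordPerm_inv_eq_iff, wordPerm_of, hr i _ rfl, ← wordPerm_of, ← wordPerm_inv_eq_iff]
  | mul v w ihv ihw =>
    obtain ⟨D, hD, hD'⟩ := ihw x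
    obtain ⟨E, hE, hE'⟩ := ihv (wordPerm q w x)
    refine ⟨D ∪ E, hD.union hE, fun r hr => ?_⟩
    rw [wordPerm_mul, wordPerm_mul, hD' r fun i y hy => hr i y (Or.inl hy),
      hE' r fun i y hy => hr i y (Or.inr hy)]

theorem wordPerm_conj {q r : ι → (M ≃[lang] M)} (h : M ≃[lang] M)
    (hr : ∀ i x, r i (h x) = h (q i x)) (w : FreeGroup ι) (x : M) :
    wordPerm r w (h x) = h (wordPerm q w x) := by
  induction w using FreeGroup.induction_on generalizing x with
  | C1 => rw [wordPerm_one, wordPerm_one]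
  | of i => rw [wordPerm_of, wordPerm_of, hr]
  | inv_of i ih =>
    rw [wordPerm_inv_eq_iff, ih, ← wordPerm_mul, mul_inv_cancel, wordPerm_one]
  | mul v w ihv ihw => rw [wordPerm_mul, wordPerm_mul, ihw, ihv]

end words

/-! ### Freedom of pairs of automorphisms fixing a branch -/

/-- For fixed `b`, `CRel x y b` amounts to `lev x b < lev y b`, so it is a strict weak order
measuring the approach to `b`. -/
theorem LevelModel.cRel_of_not_cRel {X Λ : Type*} [lang.Structure X] [LinearOrder Λ]
    (L : LevelModel X Λ) {x y z b : X} (h : CRel x y b) (h' : ¬ CRel z y b) : CRel x z b := by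
  rw [L.cRel_iff] at h h' ⊢
  have h1 := L.lev_eq h
  have h2 := L.lev_ultra x b z
  have h3 := L.lev_ultra z y b
  have h4 := L.lev_ultra y b z
  have c1 := L.lev_comm b z
  have h5 : L.lev x b < L.lev z b := by
    rw [not_lt] at h'
    rw [min_eq_right h'] at h3
    order
  have h6 : L.lev x b < L.lev b z := by rwa [c1]
  rwa [L.lev_eq h6]

theorem LevelModel.cRel_of_cRel_of_not {X Λ : Type*} [lang.Structure X] [LinearOrder Λ]
    (L : LevelModel X Λ) {x y z b : X} (h : CRel x z b) (h' : ¬ CRel x y b) : CRel y z b := by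
  by_contra hn
  exact h' (L.cRel_of_not_cRel h hn)

section freedom

variable {M Λ : Type*} [lang.Structure M] [LinearOrder Λ]

/-- Some word leads from `a` to `x`, and this is decided by the steps of the automorphisms inside
a finite subset of `T`. -/
def ReachesWithin (q : Fin 2 → (M ≃[lang] M)) (T : Set M) (a x : M) : Prop :=
  ∃ (w : FreeGroup (Fin 2)) (D : Set M), D.Finite ∧ D ⊆ T ∧ x ∈ D ∧
    ∀ r : Fin 2 → (M ≃[lang] M), (∀ i, ∀ y ∈ D, q i y ∈ D → r i y = q i y) → wordPerm r w a = x

theorem ReachesWithin.step {q : Fin 2 → (M ≃[lang] M)} {T : Set M} {a x : M}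
    (h : ReachesWithin q T a x) {i : Fin 2} (hT : q i x ∈ T) : ReachesWithin q T a (q i x) := by
  obtain ⟨w, D, hD, hDT, hx, hw⟩ := h
  refine ⟨FreeGroup.of i * w, insert (q i x) D, hD.insert _, Set.insert_subset hT hDT,
    Set.mem_insert _ _, fun r hr => ?_⟩
  rw [wordPerm_mul, hw r fun k y hy hy' => hr k y (Or.inr hy) (Or.inr hy'), wordPerm_of]
  exact hr i x (Or.inr hx) (Or.inl rfl)

theorem ReachesWithin.step_inv {q : Fin 2 → (M ≃[lang] M)} {T : Set M} {a x y : M}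
    (h : ReachesWithin q T a x) {i : Fin 2} (hy : q i y = x) (hT : y ∈ T) :
    ReachesWithin q T a y := by
  obtain ⟨w, D, hD, hDT, hx, hw⟩ := h
  refine ⟨(FreeGroup.of i)⁻¹ * w, insert y D, hD.insert _, Set.insert_subset hT hDT,
    Set.mem_insert _ _, fun r hr => ?_⟩
  rw [wordPerm_mul, hw r fun k y hy hy' => hr k y (Or.inr hy) (Or.inr hy'), wordPerm_inv_eq_iff,
    wordPerm_of, hr i y (Or.inl rfl) (hy ▸ Or.inr hx), hy]

/-- An orbit starting in `T` and not contained in `T` leaves `T` by a last letter. -/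
theorem exists_exit {q : Fin 2 → (M ≃[lang] M)} {T : Set M} {a : M} (ha : a ∈ T)
    (hT : ∃ w, wordPerm q w a ∉ T) :
    ∃ x m i, ReachesWithin q T a x ∧ (q i x = m ∨ q i m = x) ∧ m ∉ T ∧ ∃ w, wordPerm q w a = m := by
  by_contra! hcon
  have hself : ∀ x, ReachesWithin q T a x → ∃ w, wordPerm q w a = x := by
    rintro x ⟨w, D, -, -, -, hw⟩
    exact ⟨w, hw q fun _ _ _ _ => rfl⟩
  have key : ∀ (w : FreeGroup (Fin 2)) x, ReachesWithin q T a x →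
      ReachesWithin q T a (wordPerm q w x) := by
    intro w
    induction w using FreeGroup.induction_on with
    | C1 => exact fun x hx => by rwa [wordPerm_one]
    | of i =>
      intro x hx
      rw [wordPerm_of]
      refine hx.step ?_
      by_contra hn
      obtain ⟨w, hw⟩ := hself x hx
      exact hcon x (q i x) i hx (Or.inl rfl) hn (FreeGroup.of i * w)
        (by rw [wordPerm_mul, hw, wordPerm_of])
    | inv_of i ih =>
      intro x hx
      have hy : q i (wordPerm q (FreeGroup.of i)⁻¹ x) = x := by
        rw [← wordPerm_of, ← wordPerm_mul, mul_inv_cancel, wordPerm_one]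
      refine hx.step_inv hy ?_
      by_contra hn
      obtain ⟨w, hw⟩ := hself x hx
      exact hcon x _ i hx (Or.inr hy) hn ((FreeGroup.of i)⁻¹ * w) (by rw [wordPerm_mul, hw])
    | mul v w ihv ihw =>
      intro x hx
      rw [wordPerm_mul]
      exact ihv _ (ihw x hx)
  obtain ⟨w, hw⟩ := hT
  obtain ⟨_, D, -, hDT, hx, -⟩ := key w a
    ⟨1, {a}, Set.finite_singleton a, by simpa using ha, rfl, fun r _ => wordPerm_one r a⟩
  exact hw (hDT hx)

/-- If both automorphisms fix `b` and one of them moves `a < b` towards `b`, then no finite part of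
the pair decides which words fix `a`. -/
theorem exists_word_undecided (L : LevelModel M Λ) (hM : lang.IsUltrahomogeneous M)
    (q : Fin 2 → (M ≃[lang] M)) {a b : M} (hb : ∀ i, q i b = b) (hab : LtRel a b)
    (hq : ∃ i, CRel a (q i a) b) {F : Set M} (hF : F.Finite) (haF : a ∈ F) (hbF : b ∈ F) :
    ∃ (w : FreeGroup (Fin 2)) (r r' : Fin 2 → (M ≃[lang] M)),
      (∀ i, ∀ x ∈ F, r i x = q i x) ∧ (∀ i, ∀ x ∈ F, r' i x = q i x) ∧
      wordPerm r w a = a ∧ wordPerm r' w a ≠ a := by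
  classical
  have hbw := wordPerm_fixed hb
  have hC : ∀ w x y, CRel (wordPerm q w x) (wordPerm q w y) b ↔ CRel x y b := by
    intro w x y
    obtain ⟨h, hh⟩ := exists_equiv_wordPerm q w
    have := hbw w
    rw [hh] at this
    rw [hh, hh]
    conv_lhs => rw [← this]
    exact cRel_aut h
  have hlt : ∀ w, LtRel (wordPerm q w a) b := by
    intro w
    obtain ⟨h, hh⟩ := exists_equiv_wordPerm q w
    have := hbw w
    rw [hh] at this
    rw [hh, ← this]
    exact (ltRel_aut h).2 hab
  have hprog : ∀ w, ∃ w', CRel (wordPerm q w a) (wordPerm q w' a) b := by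
    intro w
    obtain ⟨i, hi⟩ := hq
    refine ⟨w * FreeGroup.of i, ?_⟩
    rw [wordPerm_mul, hC, wordPerm_of]
    exact hi
  have htrans : ∀ x y z, CRel x y b → CRel y z b → CRel x z b := fun x y z h h' =>
    L.cRel_of_not_cRel h (L.cRel_asymm h')
  let P : Set M := F ∪ ⋃ i, q i '' F
  have hP : P.Finite := hF.union (Set.finite_iUnion fun i => hF.image _)
  -- The points that the orbit of `a` eventually passes on its way to `b`. As the orbit is invariant
  -- and `b` is fixed, both automorphisms preserve this set and its complement.
  let S : Set M := {x | ∃ w, CRel x (wordPerm q w a) b}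
  have hS : ∀ i x, q i x ∈ S ↔ x ∈ S := by
    intro i x
    constructor
    · rintro ⟨w, hw⟩
      refine ⟨(FreeGroup.of i)⁻¹ * w, ?_⟩
      rwa [← hC (FreeGroup.of i), wordPerm_of, ← wordPerm_mul, mul_inv_cancel_left]
    · rintro ⟨w, hw⟩
      refine ⟨FreeGroup.of i * w, ?_⟩
      rwa [wordPerm_mul, ← wordPerm_of, hC]
  -- The orbit points beyond everything in `P` that the orbit passes. No point of `P` separates two
  -- elements of `Z` on the branch of `b`.
  let Z : Set M := {y | (∃ w, wordPerm q w a = y) ∧ ∀ x ∈ P, x ∈ S → CRel x y b}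
  have hZne : ∃ w, wordPerm q w a ∈ Z := by
    have key : ∀ Q : Set M, Q.Finite → ∃ w, ∀ x ∈ Q, x ∈ S → CRel x (wordPerm q w a) b := by
      intro Q hQ
      induction Q, hQ using Set.Finite.induction_on with
      | empty => exact ⟨1, by simp⟩
      | @insert x Q _ _ ih =>
        obtain ⟨w, hw⟩ := ih
        by_cases hx : x ∈ S
        · obtain ⟨v, hv⟩ := hx
          by_cases hwv : CRel (wordPerm q w a) (wordPerm q v a) b
          · refine ⟨v, ?_⟩
            rintro y (rfl | hy) hyS
            · exact hv
            · exact htrans _ _ _ (hw y hy hyS) hwv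
          · refine ⟨w, ?_⟩
            rintro y (rfl | hy) hyS
            · exact L.cRel_of_not_cRel hv hwv
            · exact hw y hy hyS
        · refine ⟨w, ?_⟩
          rintro y (rfl | hy) hyS
          · exact absurd hyS hx
          · exact hw y hy hyS
    obtain ⟨w, hw⟩ := key P hP
    exact ⟨w, ⟨w, rfl⟩, hw⟩
  have hOS : ∀ w, wordPerm q w a ∈ S := fun w => hprog w
  have haZ : a ∉ Z := fun h => by
    have haS := hOS 1
    rw [wordPerm_one] at haS
    exact L.cRel_ne (h.2 a (Or.inl haF) haS) rfl
  let T : Set M := {y | (∃ w, wordPerm q w a = y) ∧ y ∉ Z}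
  obtain ⟨x, m, i, ⟨w, D, hD, hDT, hxD, hw⟩, hstep, hmT, hmO⟩ :=
    exists_exit (q := q) (T := T) (a := a) ⟨⟨1, wordPerm_one q a⟩, haZ⟩
      (hZne.imp fun w hw h => h.2 hw)
  have hmZ : m ∈ Z := by
    by_contra h
    exact hmT ⟨hmO, h⟩
  -- All of `Z` has the same position relative to each point: points of `S` are far from it, the
  -- others near. A point of `D` is an orbit point outside `Z`, so some point of `P` in `S` holds it
  -- below `Z`.
  have hside : ∀ x ∈ P ∪ D, (x ∈ S ∧ ∀ z ∈ Z, CRel x z b) ∨ (x ∉ S ∧ ∀ z ∈ Z, CRel z x b) := by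
    rintro x (hx | hx)
    · by_cases hxS : x ∈ S
      · exact Or.inl ⟨hxS, fun z hz => hz.2 x hx hxS⟩
      · refine Or.inr ⟨hxS, fun z hz => ?_⟩
        obtain ⟨v, rfl⟩ := hz.1
        obtain ⟨v', hv'⟩ := hprog v
        exact L.cRel_of_not_cRel hv' fun h => hxS ⟨v', h⟩
    · obtain ⟨⟨v, rfl⟩, hvZ⟩ := hDT hx
      refine Or.inl ⟨hOS v, fun z hz => ?_⟩
      have : ∃ x₀ ∈ P, x₀ ∈ S ∧ ¬ CRel x₀ (wordPerm q v a) b := by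
        by_contra! h
        exact hvZ ⟨⟨v, rfl⟩, h⟩
      obtain ⟨x₀, h1, h2, h3⟩ := this
      exact L.cRel_of_cRel_of_not (hz.2 x₀ h1 h2) h3
  obtain ⟨j, hji⟩ : ∃ j : Fin 2, i ≠ j := by
    fin_cases i
    · exact ⟨1, by decide⟩
    · exact ⟨0, by decide⟩
  have hext : ∀ m' ∈ Z, ∃ g : M ≃[lang] M, (∀ x ∈ F, g x = q j x) ∧
      (∀ y ∈ D, q j y ∈ D → g y = q j y) ∧ g m = m' := by
    intro m' hm'
    -- The steps of `q j` to be kept. Since `q j` preserves `S`, a point of `Q` is far from `m`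
    -- exactly when its image is far from `m'`; so `m ↦ m'` is a legitimate one-point extension.
    let Q : Set M := F ∪ {y | y ∈ D ∧ q j y ∈ D}
    have hQ : Q.Finite := hF.union (hD.subset fun y hy => hy.1)
    have hQ1 : ∀ x ∈ Q, x ∈ P ∪ D := by
      rintro x (hx | hx)
      · exact Or.inl (Or.inl hx)
      · exact Or.inr hx.1
    have hQ2 : ∀ x ∈ Q, q j x ∈ P ∪ D := by
      rintro x (hx | hx)
      · exact Or.inl (Or.inr (Set.mem_iUnion.2 ⟨j, x, hx, rfl⟩))
      · exact Or.inr hx.2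
    have hmx : ∀ x ∈ Q, x ≠ m := by
      intro x hx
      rcases hside x (hQ1 x hx) with ⟨-, h⟩ | ⟨-, h⟩
      · exact L.cRel_ne (h m hmZ)
      · exact (L.cRel_ne (h m hmZ)).symm
    have hfx : ∀ x ∈ Q, q j x = Function.update (q j) m m' x := fun x hx =>
      (Function.update_of_ne (hmx x hx) _ _).symm
    have hbQ : b ∈ Q := Or.inl hbF
    have hpres : Preserves (insert m Q) (Function.update (q j) m m') := by
      refine ((Preserves.of_equiv Q (q j)).congr hfx).insert L L hbQ ?_ ?_
      · rw [Function.update_self, ← hfx b hbQ, hb]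
        obtain ⟨v, rfl⟩ := hmZ.1
        obtain ⟨v', rfl⟩ := hm'.1
        exact iff_of_true (hlt v) (hlt v')
      · intro x hx
        rw [Function.update_self, ← hfx b hbQ, ← hfx x hx, hb]
        rcases hside x (hQ1 x hx) with ⟨h1, h2⟩ | ⟨h1, h2⟩ <;>
          rcases hside (q j x) (hQ2 x hx) with ⟨h3, h4⟩ | ⟨h3, h4⟩
        · exact Or.inl ⟨h2 m hmZ, h4 m' hm'⟩
        · exact absurd ((hS j x).2 h1) h3
        · exact absurd ((hS j x).1 h3) h1
        · exact Or.inr ⟨h2 m hmZ, h4 m' hm'⟩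
    obtain ⟨g, hg⟩ := exists_equiv_of_preserves L hM (hQ.insert m) hpres
    refine ⟨g, fun x hx => ?_, fun y hy hy' => ?_, ?_⟩
    · rw [hg x (Or.inr (Or.inl hx)), hfx x (Or.inl hx)]
    · rw [hg y (Or.inr (Or.inr ⟨hy, hy'⟩)), hfx y (Or.inr ⟨hy, hy'⟩)]
    · rw [hg m (Or.inl rfl), Function.update_self]
  obtain ⟨u, hu⟩ : ∃ u : FreeGroup (Fin 2), ∀ r : Fin 2 → (M ≃[lang] M), r i = q i →
      (∀ k, ∀ y ∈ D, q k y ∈ D → r k y = q k y) → wordPerm r u a = m := by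
    rcases hstep with h | h
    · refine ⟨FreeGroup.of i * w, fun r hri hr => ?_⟩
      rw [wordPerm_mul, hw r hr, wordPerm_of, hri, h]
    · refine ⟨(FreeGroup.of i)⁻¹ * w, fun r hri hr => ?_⟩
      rw [wordPerm_mul, hw r hr, wordPerm_inv_eq_iff, wordPerm_of, hri, h]
  have hr : ∀ m' ∈ Z, ∃ r : Fin 2 → (M ≃[lang] M), (∀ k, ∀ x ∈ F, r k x = q k x) ∧
      wordPerm r u a = m ∧ r j m = m' := by
    intro m' hm'
    obtain ⟨g, hg1, hg2, hg3⟩ := hext m' hm'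
    refine ⟨Function.update q j g, fun k x hx => ?_, hu _ ?_ fun k y hy hy' => ?_, ?_⟩
    · by_cases hk : k = j
      · subst hk
        rw [Function.update_self, hg1 x hx]
      · rw [Function.update_of_ne hk]
    · rw [Function.update_of_ne hji]
    · by_cases hk : k = j
      · subst hk
        rw [Function.update_self, hg2 y hy hy']
      · rw [Function.update_of_ne hk]
    · rw [Function.update_self, hg3]
  obtain ⟨v, hv⟩ := hmZ.1
  obtain ⟨v', hv'⟩ := hprog v
  rw [hv] at hv'
  have hm'Z : wordPerm q v' a ∈ Z :=
    ⟨⟨v', rfl⟩, fun x hx hxS => htrans _ _ _ (hmZ.2 x hx hxS) hv'⟩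
  obtain ⟨r, h1, h2, h3⟩ := hr m hmZ
  obtain ⟨r', h1', h2', h3'⟩ := hr _ hm'Z
  -- The word goes to `m`, applies the free letter `j`, and returns: `r j` fixes `m`, while `r' j`
  -- moves it strictly towards `b`.
  refine ⟨u⁻¹ * (FreeGroup.of j * u), r, r', h1, h1', ?_, ?_⟩
  · rw [wordPerm_mul, wordPerm_inv_eq_iff, wordPerm_mul, wordPerm_of, h2, h3]
  · rw [wordPerm_mul, Ne, wordPerm_inv_eq_iff, wordPerm_mul, wordPerm_of, h2', h3']
    exact (L.cRel_ne hv').symm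

end freedom

/-! ### Failure of the weak amalgamation property -/

section

variable {M Λ : Type*} [lang.Structure M] [LinearOrder Λ]

/-- Any two embeddings of a finite structure are conjugate under an automorphism. -/
theorem exists_equiv_comp_eq (L : LevelModel M Λ) (hM : lang.IsUltrahomogeneous M) {S : Type*}
    [lang.Structure S] [Finite S] (g h : S ↪[lang] M) : ∃ k : M ≃[lang] M, ∀ x, k (g x) = h x := by
  have happ : ∀ x, Function.extend g h id (g x) = h x := fun x =>
    g.injective.extend_apply h id x
  obtain ⟨k, hk⟩ := exists_equiv_of_preserves L hM (Set.finite_range g)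
    (f := Function.extend g h id) (by
      constructor
      · rintro _ ⟨x, rfl⟩ _ ⟨y, rfl⟩
        rw [happ, happ, ltRel_map, ltRel_map]
      · rintro _ ⟨x, rfl⟩ _ ⟨y, rfl⟩ _ ⟨z, rfl⟩
        rw [happ, happ, happ, cRel_map, cRel_map])
  exact ⟨k, fun x => (hk _ ⟨x, rfl⟩).trans (happ x)⟩

/-- The partial automorphisms of a system embedded in an ultrahomogeneous structure extend to
automorphisms. -/
theorem PartialAutSystem.exists_extension (L : LevelModel M Λ) (hM : lang.IsUltrahomogeneous M)
    {n : ℕ} (A : PartialAutSystem SB.{u} n) (e : A.carrier ↪[lang] M) :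
    ∃ q : Fin n → (M ≃[lang] M), ∀ (i : Fin n) (x : (A.aut i).dom),
      q i (e (x : A.carrier)) = e ((A.aut i).toEquiv x : A.carrier) := by
  have hfin : Finite A.carrier := A.mem.1
  have : ∀ i : Fin n, ∃ k : M ≃[lang] M, ∀ x : (A.aut i).dom,
      k (e (x : A.carrier)) = e ((A.aut i).toEquiv x : A.carrier) := fun i =>
    exists_equiv_comp_eq L hM (e.comp (A.aut i).dom.subtype)
      (e.comp ((A.aut i).cod.subtype.comp (A.aut i).toEquiv.toEmbedding))
  choose q hq using this
  exact ⟨q, hq⟩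

/-- There is a pair of automorphisms fixing a point `b` of which one moves a point `a < b`
towards `b`. -/
theorem exists_moving_pair (e : UnivTree.{u} ≃[lang] M) : ∃ (q : Fin 2 → (M ≃[lang] M)) (a b : M),
      (∀ i, q i b = b) ∧ LtRel a b ∧ CRel a (q 0 a) b := by
  classical
  let U := UnivTree.levelModel.{u}
  -- The leaves `⟨{0}⟩` and `⟨{1}⟩` leave the branch of `⟨∅⟩` at the levels 0 and 1. Both colours
  -- are 1, so both leaves lie to the left of `⟨∅⟩`, and sending the first to the second is a move
  -- towards it.
  have h0 : color 0 = true := color_eq_true.2 ⟨0, 0, by norm_num⟩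
  have h1 : color 1 = true := color_eq_true.2 ⟨1, 0, by norm_num⟩
  have hlev : ∀ q, UnivTree.lev.{u} ⟨{q}⟩ ⟨∅⟩ = q := by
    intro q
    change (symmDiff {q} (⊥ : Finset ℚ)).min = q
    rw [symmDiff_bot, Finset.min_singleton]
  have hlt : ∀ q, color q = true → LtRel (⟨{q}⟩ : UnivTree.{u}) ⟨∅⟩ := fun q hq =>
    UnivTree.ltRel_iff.2 ⟨q, hlev q, by simp [UnivTree.bit, hq], by simp [UnivTree.bit, hq]⟩
  have hC : CRel (⟨{0}⟩ : UnivTree.{u}) ⟨{1}⟩ ⟨∅⟩ := by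
    refine U.cRel_swap (U.cRel_iff.2 ?_)
    rw [U.lev_comm ⟨∅⟩]
    change UnivTree.lev ⟨{0}⟩ ⟨∅⟩ < UnivTree.lev ⟨{1}⟩ ⟨∅⟩
    rw [hlev, hlev]
    exact WithTop.coe_lt_coe.2 one_pos
  have hne : ∀ q, color q = true → (⟨{q}⟩ : UnivTree.{u}) ≠ ⟨∅⟩ := fun q hq => (hlt q hq).2
  let f : UnivTree.{u} → UnivTree.{u} := Function.update id ⟨{0}⟩ ⟨{1}⟩
  have hf : f ⟨∅⟩ = ⟨∅⟩ := Function.update_of_ne (hne 0 h0).symm _ _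
  have hf' : f ⟨{0}⟩ = ⟨{1}⟩ := Function.update_self _ _ _
  have hpres : Preserves (insert ⟨{0}⟩ {⟨∅⟩}) f := by
    refine Preserves.insert U U (b := ⟨∅⟩) ?_ rfl ?_ ?_
    · refine ⟨?_, ?_⟩
      · rintro x rfl y rfl
        rw [hf]
      · rintro x rfl y rfl z rfl
        rw [hf]
    · rw [hf, hf']
      exact iff_of_true (hlt 0 h0) (hlt 1 h1)
    · rintro x rfl
      rw [hf, hf']
      exact Or.inr ⟨U.cRel_self (hne 0 h0), U.cRel_self (hne 1 h1)⟩
  obtain ⟨g, hg⟩ := exists_equiv_of_preserves U univTree_isUltrahomogeneous (Set.toFinite _) hpres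
  refine ⟨fun i => if i = 0 then (e.comp g).comp e.symm else Language.Equiv.refl lang M,
    e ⟨{0}⟩, e ⟨∅⟩, ?_, (ltRel_aut e).2 (hlt 0 h0), ?_⟩
  · intro i
    by_cases hi : i = 0
    · simp only [hi, if_true, Language.Equiv.comp_apply, Language.Equiv.symm_apply_apply]
      rw [hg _ (Or.inr rfl), hf]
    · simp only [hi, if_false, Language.Equiv.refl_apply]
  · simp only [if_true, Language.Equiv.comp_apply, Language.Equiv.symm_apply_apply]
    rw [hg _ (Or.inl rfl), hf', cRel_aut]
    exact hC

end

section restriction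

/-- The points of `F` and their images under the automorphisms `q i`. -/
noncomputable def imageSpan {n : ℕ} (q : Fin n → (UnivTree.{u} ≃[lang] UnivTree.{u})) (F : Set UnivTree.{u}) :
    Set UnivTree.{u} := F ∪ ⋃ i, q i '' F

/-- The restriction of an automorphism `q i` to the finite set `F`. -/
noncomputable def restrictAut {n : ℕ} (q : Fin n → (UnivTree.{u} ≃[lang] UnivTree.{u})) (F : Set UnivTree.{u})
    (i : Fin n) : (subOf {x : subOf (imageSpan q F) | (x : UnivTree.{u}) ∈ F}) ↪[lang]
      subOf (imageSpan q F) :=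
  Embedding.codRestrict (subOf (imageSpan q F))
    ((q i).toEmbedding.comp ((subOf (imageSpan q F)).subtype.comp (Substructure.subtype _)))
    fun x => Or.inr (Set.mem_iUnion.2 ⟨i, _, x.2, rfl⟩)

/-- The finite system given by the restrictions of automorphisms to a finite set. -/
noncomputable def restrictSystem {n : ℕ} (q : Fin n → (UnivTree.{u} ≃[lang] UnivTree.{u}))
    {F : Set UnivTree.{u}} (hF : F.Finite) : PartialAutSystem SB.{u} n where
  carrier := ⟨subOf (imageSpan q F), inferInstance⟩
  mem := by
    have : Finite (subOf (imageSpan q F)) :=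
      (hF.union (Set.finite_iUnion fun i => hF.image _) : (imageSpan q F).Finite)
    exact mem_SB_of_embedding (A := ⟨subOf (imageSpan q F), inferInstance⟩)
      (subOf (imageSpan q F)).subtype
  aut i := ⟨_, _, (restrictAut q F i).equivRange⟩

variable {n : ℕ} {q : Fin n → (UnivTree.{u} ≃[lang] UnivTree.{u})} {F : Set UnivTree.{u}}
  (hF : F.Finite)

/-- The inclusion of the carrier of a restricted system. -/
noncomputable def restrictSystemSubtype : (restrictSystem q hF).carrier ↪[lang] UnivTree.{u} :=
  (subOf (imageSpan q F)).subtype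

/-- A point of the domain, as a point of the carrier. -/
noncomputable def restrictSystemMk (x : UnivTree.{u}) (hx : x ∈ F) : (restrictSystem q hF).carrier :=
  (⟨x, Or.inl hx⟩ : subOf (imageSpan q F))

theorem restrictSystemSubtype_mk (x : UnivTree.{u}) (hx : x ∈ F) :
    restrictSystemSubtype hF (restrictSystemMk (q := q) hF x hx) = x := rfl

theorem restrictSystemMk_mem_dom (x : UnivTree.{u}) (hx : x ∈ F) (i : Fin n) :
    restrictSystemMk hF x hx ∈ ((restrictSystem q hF).aut i).dom := hx

theorem restrictSystem_aut_apply (x : UnivTree.{u}) (hx : x ∈ F) (i : Fin n) :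
    restrictSystemSubtype hF (((restrictSystem q hF).aut i).toEquiv
      ⟨restrictSystemMk hF x hx, restrictSystemMk_mem_dom hF x hx i⟩ :
        (restrictSystem q hF).carrier) = q i x := rfl

/-- A system embedded in the universal tree embeds in the restrictions of automorphisms extending
its partial automorphisms. -/
theorem exists_systemEmbedding_restrict {A : PartialAutSystem SB.{u} n}
    (e : A.carrier ↪[lang] UnivTree.{u}) (he : Set.range e ⊆ F)
    (hq : ∀ (i : Fin n) (x : (A.aut i).dom),
      q i (e (x : A.carrier)) = e ((A.aut i).toEquiv x : A.carrier)) :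
    ∃ α : SystemEmbedding A (restrictSystem q hF),
      ∀ x, restrictSystemSubtype hF (α.toEmbedding x) = e x := by
  refine ⟨⟨Embedding.codRestrict (subOf (imageSpan q F)) e fun x => Or.inl (he ⟨x, rfl⟩),
    fun i x => ⟨he ⟨x, rfl⟩, ?_⟩⟩, fun x => rfl⟩
  apply (restrictSystemSubtype hF).injective
  exact (restrictSystem_aut_apply hF _ (he ⟨x, rfl⟩) i).trans (hq i x)

/-- An embedding of a restricted system is induced by an automorphism `k`, which transports the
values of the words decided by the system. -/
theorem exists_equiv_of_systemEmbedding {D : PartialAutSystem SB.{u} n}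
    (γ : SystemEmbedding (restrictSystem q hF) D) (e : D.carrier ↪[lang] UnivTree.{u})
    {s : Fin n → (UnivTree.{u} ≃[lang] UnivTree.{u})}
    (hs : ∀ (i : Fin n) (x : (D.aut i).dom),
      s i (e (x : D.carrier)) = e ((D.aut i).toEquiv x : D.carrier))
    {w : FreeGroup (Fin n)} {x : UnivTree.{u}}
    (hw : ∀ r : Fin n → (UnivTree.{u} ≃[lang] UnivTree.{u}), (∀ i, ∀ y ∈ F, r i y = q i y) →
      wordPerm r w x = wordPerm q w x) :
    ∃ k : UnivTree.{u} ≃[lang] UnivTree.{u},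
      (∀ y, k (restrictSystemSubtype hF y) = e (γ.toEmbedding y)) ∧
      wordPerm s w (k x) = k (wordPerm q w x) := by
  have hfin : Finite (restrictSystem q hF).carrier := (restrictSystem q hF).mem.1
  obtain ⟨k, hk⟩ := exists_equiv_comp_eq UnivTree.levelModel univTree_isUltrahomogeneous
    (restrictSystemSubtype (q := q) hF) (e.comp γ.toEmbedding)
  refine ⟨k, hk, ?_⟩
  -- Pulled back along `k`, the tuple `s` agrees with `q` on `F`, so the decided word takes the same
  -- value for it.
  let r : Fin n → (UnivTree.{u} ≃[lang] UnivTree.{u}) := fun i => (k.symm.comp (s i)).comp k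
  have hr : ∀ i, ∀ y ∈ F, r i y = q i y := by
    intro i y hy
    obtain ⟨h1, h2⟩ := γ.map_aut i ⟨restrictSystemMk hF y hy, restrictSystemMk_mem_dom hF y hy i⟩
    have h3 := hs i ⟨_, h1⟩
    rw [h2] at h3
    have h4 := hk (((restrictSystem q hF).aut i).toEquiv
      ⟨restrictSystemMk hF y hy, restrictSystemMk_mem_dom hF y hy i⟩)
    rw [restrictSystem_aut_apply] at h4
    have h5 := hk (restrictSystemMk hF y hy)
    rw [restrictSystemSubtype_mk] at h5
    change k.symm (s i (k y)) = q i y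
    rw [h5]
    change k.symm (s i (e (γ.toEmbedding (restrictSystemMk hF y hy)))) = q i y
    rw [h3]
    change k (q i y) = e _ at h4
    rw [← Language.Equiv.symm_apply_apply k (q i y), h4]
  rw [← hw r hr]
  refine wordPerm_conj k (fun i y => ?_) w x
  change s i (k y) = k (k.symm (s i (k y)))
  rw [Language.Equiv.apply_symm_apply]

end restriction

/-- The system on `{a, b}` already records that `b` is fixed and that `a` moves towards it, and
these facts persist in every extension `A'`. So `exists_word_undecided` applies with `F` the whole
of `A'`, and yields two extensions that disagree on whether a word fixes the image of `a`. -/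
theorem not_hasWAP_SB : ¬ HasWAP SB.{u} 2 := by
  intro H
  let U := UnivTree.levelModel.{u}
  have hU := univTree_isUltrahomogeneous.{u}
  obtain ⟨q, a, b, hb, hab, hq⟩ := exists_moving_pair (Language.Equiv.refl lang UnivTree.{u})
  have hF : ({a, b} : Set UnivTree.{u}).Finite := Set.toFinite _
  have haF : a ∈ ({a, b} : Set UnivTree.{u}) := Or.inl rfl
  have hbF : b ∈ ({a, b} : Set UnivTree.{u}) := Or.inr rfl
  obtain ⟨A', φ, hA'⟩ := H (restrictSystem q hF)
  obtain ⟨e⟩ := nonempty_embedding_of_mem_SB A'.mem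
  have hfin : Finite A'.carrier := A'.mem.1
  obtain ⟨q', hq'⟩ := A'.exists_extension U hU e
  let A := restrictSystem q hF
  have haut : ∀ (i : Fin 2) (x : UnivTree.{u}) (hx : x ∈ ({a, b} : Set UnivTree.{u})),
      q' i (e (φ.toEmbedding (restrictSystemMk hF x hx))) = e (φ.toEmbedding
        ((A.aut i).toEquiv ⟨restrictSystemMk hF x hx, restrictSystemMk_mem_dom hF x hx i⟩ :
          A.carrier)) := by
    intro i x hx
    obtain ⟨h1, h2⟩ := φ.map_aut i ⟨restrictSystemMk hF x hx, restrictSystemMk_mem_dom hF x hx i⟩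
    rw [← h2]
    exact hq' i ⟨_, h1⟩
  let a' := e (φ.toEmbedding (restrictSystemMk hF a haF))
  let b' := e (φ.toEmbedding (restrictSystemMk hF b hbF))
  have hb' : ∀ i, q' i b' = b' := by
    intro i
    change q' i (e (φ.toEmbedding (restrictSystemMk hF b hbF))) = _
    rw [haut]
    refine congrArg (fun y => e (φ.toEmbedding y)) ((restrictSystemSubtype hF).injective ?_)
    rw [restrictSystem_aut_apply, restrictSystemSubtype_mk, hb]
  have hab' : LtRel a' b' := by
    rw [ltRel_map, ltRel_map, ← ltRel_map (restrictSystemSubtype hF)]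
    exact hab
  have hprog : CRel a' (q' 0 a') b' := by
    change CRel _ (q' 0 (e (φ.toEmbedding (restrictSystemMk hF a haF)))) _
    rw [haut, cRel_map, cRel_map, ← cRel_map (restrictSystemSubtype hF), restrictSystem_aut_apply]
    exact hq
  obtain ⟨w, r, r', hr, hr', h1, h2⟩ := exists_word_undecided U hU q' hb' hab' ⟨0, hprog⟩
    (Set.finite_range e) ⟨_, rfl⟩ ⟨_, rfl⟩
  -- Enlarging the domains by `E` and `E₂` makes the value of `w` at `a'` part of the finite systems
  -- `B` and `C`, so that it survives in `D`.
  obtain ⟨E, hE, hE'⟩ := exists_finite_wordPerm_eq r w a'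
  obtain ⟨E₂, hE₂, hE₂'⟩ := exists_finite_wordPerm_eq r' w a'
  have hB := (Set.finite_range e).union hE
  have hC := (Set.finite_range e).union hE₂
  obtain ⟨α, hα⟩ := exists_systemEmbedding_restrict (q := r) hB e Set.subset_union_left
    fun i x => (hr i _ ⟨_, rfl⟩).trans (hq' i x)
  obtain ⟨β, hβ⟩ := exists_systemEmbedding_restrict (q := r') hC e Set.subset_union_left
    fun i x => (hr' i _ ⟨_, rfl⟩).trans (hq' i x)
  obtain ⟨D, γ, δ, hD⟩ := hA' _ _ α β
  obtain ⟨d⟩ := nonempty_embedding_of_mem_SB D.mem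
  obtain ⟨s, hs⟩ := D.exists_extension U hU d
  obtain ⟨k, hk, hk'⟩ := exists_equiv_of_systemEmbedding hB γ d hs (w := w) (x := a')
    fun t ht => hE' t fun i y hy => ht i y (Or.inr hy)
  obtain ⟨l, hl, hl'⟩ := exists_equiv_of_systemEmbedding hC δ d hs (w := w) (x := a')
    fun t ht => hE₂' t fun i y hy => ht i y (Or.inr hy)
  have hkl : k a' = l a' := by
    have e1 := hk (α.toEmbedding (φ.toEmbedding (restrictSystemMk hF a haF)))
    have e2 := hl (β.toEmbedding (φ.toEmbedding (restrictSystemMk hF a haF)))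
    rw [hα] at e1
    rw [hβ] at e2
    rw [e1, e2, hD]
  rw [h1, hkl, hl'] at hk'
  exact h2 (l.injective hk')

/-! ### The topology of the automorphism group -/

section topology

variable {M : Type u} [lang.Structure M]

theorem isOpen_setOf_apply_eq (x y : M) : IsOpen {g : M ≃[lang] M | g x = y} := by
  let : TopologicalSpace M := ⊥
  have : DiscreteTopology M := ⟨rfl⟩
  have h : Continuous fun g : M ≃[lang] M => (g : M → M) := continuous_induced_dom
  exact (isOpen_discrete {y}).preimage ((continuous_apply x).comp h)

theorem isOpen_setOf_agree {n : ℕ} (g : Fin n → (M ≃[lang] M)) {F : Set M} (hF : F.Finite) :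
    IsOpen {g' : Fin n → (M ≃[lang] M) | ∀ i, ∀ x ∈ F, g' i x = g i x} := by
  simp only [Set.ofPred_forall]
  refine isOpen_iInter_of_finite fun i => hF.isOpen_biInter fun x _ => ?_
  exact (isOpen_setOf_apply_eq x (g i x)).preimage
    (f := fun g' : Fin n → (M ≃[lang] M) => g' i) (continuous_apply i)

theorem exists_finite_agree_subset {n : ℕ} {V : Set (Fin n → (M ≃[lang] M))} (hV : IsOpen V)
    {g : Fin n → (M ≃[lang] M)} (hg : g ∈ V) : ∃ F : Set M, F.Finite ∧
      ∀ g' : Fin n → (M ≃[lang] M), (∀ i, ∀ x ∈ F, g' i x = g i x) → g' ∈ V := by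
  let : TopologicalSpace M := ⊥
  obtain ⟨I, v, hv, hIV⟩ := isOpen_pi_iff.1 hV g hg
  have key : ∀ i : Fin n, ∃ F : Set M, F.Finite ∧ (i ∈ I → ∀ h : M ≃[lang] M,
      (∀ x ∈ F, h x = g i x) → h ∈ v i) := by
    intro i
    by_cases hi : i ∈ I
    · obtain ⟨h1, h2⟩ := hv i hi
      obtain ⟨W, hW, hWv⟩ := isOpen_induced_iff.1 h1
      rw [← hWv] at h2
      obtain ⟨J, z, hz, hJ⟩ := isOpen_pi_iff.1 hW _ h2
      refine ⟨J, J.finite_toSet, fun _ h hh => ?_⟩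
      rw [← hWv]
      refine hJ fun x hx => ?_
      change h x ∈ z x
      rw [hh x hx]
      exact (hz x hx).2
    · exact ⟨∅, Set.finite_empty, fun h => absurd h hi⟩
  choose F hF hF' using key
  refine ⟨⋃ i, F i, Set.finite_iUnion hF, fun g' hg' => hIV fun i hi => ?_⟩
  exact hF' i hi (g' i) fun x hx => hg' i x (Set.mem_iUnion.2 ⟨i, hx⟩)

/-- A pointwise limit of automorphisms need not be surjective, so the inverse is recorded too: `g ↦
(g, g⁻¹)` has closed image in a Polish space. It induces the given topology, because `g⁻¹ x = y` is
the open condition `g y = x`. Polishness is needed for the Baire category argument. -/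
theorem polishSpace_aut [Countable M] : PolishSpace (M ≃[lang] M) := by
  let : TopologicalSpace M := ⊥
  have : DiscreteTopology M := ⟨rfl⟩
  have hM : PolishSpace M := inferInstance
  let ι : (M ≃[lang] M) → (M → M) × (M → M) := fun g => (g, g.symm)
  have hcoe : Continuous fun g : M ≃[lang] M => (g : M → M) := continuous_induced_dom
  have hsymm : Continuous fun g : M ≃[lang] M => (g.symm : M → M) := by
    refine continuous_pi fun x => continuous_discrete_rng.2 fun y => ?_
    convert isOpen_setOf_apply_eq (M := M) y x using 1
    ext g
    simp only [Set.mem_preimage, Set.mem_singleton_iff, Set.mem_ofPred_eq]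
    constructor
    · rintro rfl
      exact g.apply_symm_apply x
    · rintro rfl
      exact g.symm_apply_apply y
  have hι : Topology.IsInducing ι :=
    Topology.IsInducing.of_comp (hcoe.prodMk hsymm) continuous_fst ⟨rfl⟩
  have hinj : Function.Injective ι := fun g h hgh => DFunLike.coe_injective (congrArg Prod.fst hgh)
  have heval : Continuous fun p : (M → M) × M => p.1 p.2 :=
    continuous_prod_of_discrete_right.2 fun m => continuous_apply m
  have hrange : Set.range ι = {p | ∀ x, p.1 (p.2 x) = x} ∩ {p | ∀ x, p.2 (p.1 x) = x} ∩
      {p | ∀ (n : ℕ) (r : lang.Relations n) (v : Fin n → M),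
        p.1 ∘ v ∈ {w : Fin n → M | Structure.RelMap r w ↔ Structure.RelMap r v}} := by
    ext p
    constructor
    · rintro ⟨g, rfl⟩
      exact ⟨⟨g.apply_symm_apply, g.symm_apply_apply⟩, fun n r v => g.map_rel r v⟩
    · rintro ⟨⟨h1, h2⟩, h3⟩
      exact ⟨{ toFun := p.1, invFun := p.2, left_inv := h2, right_inv := h1,
               map_fun' := fun f => isEmptyElim f, map_rel' := fun r v => h3 _ r v }, rfl⟩
  have hclosed : IsClosed (Set.range ι) := by
    rw [hrange]
    refine (IsClosed.inter ?_ ?_).inter ?_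
    · simp only [Set.ofPred_forall]
      refine isClosed_iInter fun x => isClosed_eq ?_ continuous_const
      exact heval.comp (continuous_fst.prodMk ((continuous_apply x).comp continuous_snd))
    · simp only [Set.ofPred_forall]
      refine isClosed_iInter fun x => isClosed_eq ?_ continuous_const
      exact heval.comp (continuous_snd.prodMk ((continuous_apply x).comp continuous_fst))
    · simp only [Set.ofPred_forall]
      refine isClosed_iInter fun n => isClosed_iInter fun r => isClosed_iInter fun v => ?_
      refine (isClosed_discrete _).preimage (f := fun p : (M → M) × (M → M) => p.1 ∘ v) ?_
      exact continuous_pi fun i => (continuous_apply (v i)).comp continuous_fst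
  exact (Topology.IsClosedEmbedding.mk ⟨hι, hinj⟩ hclosed).polishSpace

end topology

/-! ### The absence of comeager diagonal conjugacy classes -/

/-- A comeager class meets the open set of pairs fixing `b₁` and moving `a₁` as prescribed;
conjugating back, `f` itself fixes a point `b` and moves some `a < b` towards it. -/
theorem not_hasComeagerDiagonalClass {M : Type u} [lang.Structure M] [Countable M]
    (hM : IsFraisseLimit SB.{u} M) : ¬ HasComeagerDiagonalClass lang M 2 := by
  rintro ⟨f, hf⟩
  have hpol : PolishSpace (M ≃[lang] M) := polishSpace_aut
  obtain ⟨e⟩ := univTree_isFraisseLimit.{u}.nonempty_equiv hM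
  let L : LevelModel M (WithTop ℚ) := UnivTree.levelModel.comap e.symm.toEmbedding
  have hu := hM.ultrahomogeneous
  obtain ⟨q, a₁, b₁, hb₁, hab₁, hq₁⟩ := exists_moving_pair e
  obtain ⟨t, htf, ht, htd⟩ := mem_residual.1 hf
  -- a member of the class which fixes a point and moves another one towards it
  obtain ⟨g₀, hg₀, hg₀t⟩ := htd.inter_open_nonempty _
    (isOpen_setOf_agree q (Set.toFinite {a₁, b₁})) ⟨q, fun _ _ _ => rfl⟩
  obtain ⟨h₀, hh₀⟩ := htf hg₀t
  let a := h₀.symm a₁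
  let b := h₀.symm b₁
  have hfg : ∀ i x, f i (h₀.symm x) = h₀.symm (g₀ i x) := by
    intro i x
    rw [hh₀ i, Language.Equiv.comp_apply, Language.Equiv.comp_apply,
      Language.Equiv.symm_apply_apply]
  have hb : ∀ i, f i b = b := by
    intro i
    change f i (h₀.symm b₁) = _
    rw [hfg, hg₀ i b₁ (Or.inr rfl), hb₁]
  have hab : LtRel a b := (ltRel_aut h₀.symm).2 hab₁
  have hfa : CRel a (f 0 a) b := by
    change CRel _ (f 0 (h₀.symm a₁)) _
    rw [hfg, cRel_aut, hg₀ 0 a₁ (Or.inl rfl)]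
    exact hq₁
  -- The conjugates of `f` by maps sending `(a, b)` to `c`. There are countably many pieces, and
  -- within one of them a word fixes `c.1` if and only if it fixes `a` under `f`.
  let Y : M × M → Set (Fin 2 → (M ≃[lang] M)) := fun c =>
    {g | ∃ h : M ≃[lang] M, h a = c.1 ∧ h b = c.2 ∧ ∀ i, g i = (h.comp (f i)).comp h.symm}
  have hcover : t ⊆ ⋃ c, closure (Y c) := by
    intro g hg
    obtain ⟨h, hh⟩ := htf hg
    exact Set.mem_iUnion.2 ⟨(h a, h b), subset_closure ⟨h, rfl, rfl, hh⟩⟩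
  obtain ⟨g₁, -, hg₁⟩ := (ht.dense_iUnion_interior_of_closed htd (fun c => isClosed_closure)
    hcover).inter_open_nonempty Set.univ isOpen_univ ⟨q, trivial⟩
  obtain ⟨c, hc⟩ := Set.mem_iUnion.1 hg₁
  obtain ⟨g, hgV, h, hha, hhb, hg⟩ := mem_closure_iff.1 (interior_subset hc) _ isOpen_interior hc
  have hgh : ∀ i x, g i (h x) = h (f i x) := by
    intro i x
    rw [hg i, Language.Equiv.comp_apply, Language.Equiv.comp_apply,
      Language.Equiv.symm_apply_apply]
  obtain ⟨F, hF, hFV⟩ := exists_finite_agree_subset isOpen_interior hgV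
  obtain ⟨w, r, r', hr, hr', h1, h2⟩ := exists_word_undecided L hu g (a := h a) (b := h b)
    (F := F ∪ {h a, h b}) (fun i => by rw [hgh, hb]) ((ltRel_aut h).2 hab)
    ⟨0, by rw [hgh, cRel_aut]; exact hfa⟩ (hF.union (Set.toFinite _)) (Or.inr (Or.inl rfl))
    (Or.inr (Or.inr rfl))
  -- Such an `s` lies in the closure of `Y c`, and the value of `w` at `h a` depends on finitely
  -- many values. So a member of `Y c` close to `s` gives the same value, and the answer is that of
  -- `f`.
  have key : ∀ s : Fin 2 → (M ≃[lang] M), (∀ i, ∀ x ∈ F ∪ {h a, h b}, s i x = g i x) →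
      (wordPerm s w (h a) = h a ↔ wordPerm f w a = a) := by
    intro s hs
    obtain ⟨E, hE, hE'⟩ := exists_finite_wordPerm_eq s w (h a)
    have hsV := hFV s fun i x hx => hs i x (Or.inl hx)
    obtain ⟨p, hpE, k, hka, -, hp⟩ := mem_closure_iff.1 (interior_subset hsV) _
      (isOpen_setOf_agree s hE) fun _ _ _ => rfl
    have hpk : ∀ i x, p i (k x) = k (f i x) := by
      intro i x
      rw [hp i, Language.Equiv.comp_apply, Language.Equiv.comp_apply,
        Language.Equiv.symm_apply_apply]
    rw [← hE' p hpE, hha, ← hka, wordPerm_conj k hpk]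
    exact k.injective.eq_iff
  exact h2 ((key r' hr').2 ((key r hr).1 h1))

end OrderedBoron

theorem mainTheorem4 :
    ¬ OrderedBoron.HasWAP OrderedBoron.SB.{u} 2 ∧
    ∀ (M : Type u) [OrderedBoron.lang.Structure M] [Countable M],
      FirstOrder.Language.IsFraisseLimit OrderedBoron.SB.{u} M →
        ¬ OrderedBoron.HasComeagerDiagonalClass OrderedBoron.lang M 2 :=
  ⟨OrderedBoron.not_hasWAP_SB, fun _ _ _ hM => OrderedBoron.not_hasComeagerDiagonalClass hM⟩
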